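/- Let $\xi(s)=\tfrac12 s(s-1)\pi^{-s/2}\Gamma(s/2)\zeta(s)$, let $\omega>0$ be real and $\nu\ge 1$ an integer with $\omega\nu>1$, and let $K=K_\zeta^{\omega,\nu}$ be the continuous function on $\mathbb R$ that vanishes for $x<0$ and satisfies $$\left(\frac{\xi(s-\omega)}{\xi(s+\omega)}\right)^{\nu}=\int_{-\infty}^{\infty}K(x)e^{izx}\,dx,\qquad s=\tfrac12-iz,$$ for all $z$ with sufficiently large imaginary part; explicitly $K(x)=\frac1{2\pi}\int_{\operatorname{Im} z=1+\omega}\left(\frac{\xi(1/2-iz-\omega)}{\xi(1/2-iz+\omega)}\right)^{\nu}e^{-izx}\,dz$ for $x\ge 0$. For $t\ge 0$ let $\mathsf K[t]$ be the operator on $L^2(-\infty,t)$ given by $(\mathsf K[t]f)(x)=\mathbf 1_{(-\infty,t]}(x)\int_{-\infty}^{t}K(x+y)f(y)\,dy$, and let $\det$ denote the Fredholm determinant. Let $\tau>0$ be such that $\det(1+\mathsf K[t])\ne0$ and $\det(1-\mathsf K[t])\ne 0$ for every $0\le t<\tau$, and put $m(t)=\det(1+\mathsf K[t])/\det(1-\mathsf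 K[t])$. Then for every $0<t<\tau$ each of the integral equations $$\Phi(t,x)+\int_{-\infty}^{t}K(x+y)\Phi(t,y)\,dy=\mathbf 1_{[-t,t]}(x),\qquad \Psi(t,x)-\int_{-\infty}^{t}K(x+y)\Psi(t,y)\,dy=\mathbf 1_{[-t,t]}(x),$$ $$\phi^{\pm}(t,x)\pm\int_{-\infty}^{t}K(x+y)\phi^{\pm}(t,y)\,dy=K(x+t)\qquad(x\le t)$$ has a unique solution in $L^2(-\infty,t)$; take the representatives that satisfy the equations at every $x\le t$. For every $0<t<\tau$: (1) $\Phi(t,x)$ and $\Psi(t,x)$ are continuous functions of $x$ on $[-t,t]$ and vanish for $x<-t$; moreover $\Phi(t,t)=\lim_{x\to t^-}\Phi(t,x)\neq0$ and $\Psi(t,t)=\lim_{x\to t^-}\Psi(t,x)\ne0$. (2) For every $x<t$ with $x\neq -t$ the partial derivatives below exist and $$\phi^+(t,x)=-\frac{1}{\Phi(t,t)}\frac{\partial}{\partial t}\Phi(t,x)=\frac1{\Psi(t,t)}\frac{\partial}{\partial x}\Psi(t,x),$$ $$\phi^-(t,x)=-\frac{1}{\Phi(t,t)}\frac{\partial}{\partial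 x}\Phi(t,x)=\frac1{\Psi(t,t)}\frac{\partial}{\partial t}\Psi(t,x).$$ At $x=\pm t$ the same formulas hold with one-sided derivatives, namely the right derivative in $t$ and the derivative in $x$ from within $[-t,t]$. (3) $m(t)=\dfrac1{\Phi(t,t)}=\Psi(t,t)$. -/

import Mathlib

open MeasureTheory Set Filter Topology

noncomputable section

/-- The Riemann xi-function `ξ(s) = (1/2) s (s-1) π^(-s/2) Γ(s/2) ζ(s)`, as an entire function.
Since `π^(-s/2) Γ(s/2) ζ(s) = Λ₀(s) - 1/s - 1/(1-s)` with `Λ₀` entire, one has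
`ξ(s) = (s (s-1) Λ₀(s) + 1) / 2`; see `riemannXi_eq`. -/
def riemannXi (s : ℂ) : ℂ := (s * (s - 1) * completedRiemannZeta₀ s + 1) / 2

/-- The entire function `riemannXi` agrees with the usual formula away from the points where
that formula needs a limit. -/
theorem riemannXi_eq (s : ℂ) (h0 : s ≠ 0) (h1 : s ≠ 1) (hG : Complex.Gammaℝ s ≠ 0) :
    riemannXi s =
      1 / 2 * s * (s - 1) * (Real.pi : ℂ) ^ (-s / 2) * Complex.Gamma (s / 2) * riemannZeta s := by
  have h1' : (1 : ℂ) - s ≠ 0 := sub_ne_zero.mpr (Ne.symm h1)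
  have e : riemannZeta s * ((Real.pi : ℂ) ^ (-s / 2) * Complex.Gamma (s / 2)) =
      completedRiemannZeta s := by
    rw [← Complex.Gammaℝ_def, riemannZeta_def_of_ne_zero h0, div_mul_cancel₀ _ hG]
  have e2 : 1 / 2 * s * (s - 1) * (Real.pi : ℂ) ^ (-s / 2) * Complex.Gamma (s / 2)
      * riemannZeta s = 1 / 2 * s * (s - 1) * completedRiemannZeta s := by
    rw [← e]; ring
  rw [e2, completedRiemannZeta_eq, riemannXi]
  field_simp
  ring

/-- `Θ(z) = (ξ(s-ω) / ξ(s+ω))^ν` with `s = 1/2 - i z`. -/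
def xiQuotient (ω : ℝ) (ν : ℕ) (z : ℂ) : ℂ :=
  (riemannXi (1 / 2 - Complex.I * z - ω) / riemannXi (1 / 2 - Complex.I * z + ω)) ^ ν

/-- The kernel `K = K_ζ^{ω,ν}`, i.e. the function with `Θ(z) = ∫ K(x) e^{izx} dx` and `K(x) = 0`
for `x < 0`, given by Fourier inversion on the horizontal line `Im z = 1 + ω`:
`K(x) = (1/2π) ∫_{Im z = 1 + ω} Θ(z) e^{-izx} dz` for `x ≥ 0`.
On this line `Re (s - ω) = 3/2`, inside the half-plane of absolute convergence of `ζ`. -/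
def xiKernel (ω : ℝ) (ν : ℕ) (x : ℝ) : ℂ :=
  if x < 0 then 0
  else (1 / (2 * Real.pi : ℂ)) * ∫ u : ℝ,
    xiQuotient ω ν (u + (1 + ω) * Complex.I)
      * Complex.exp (-(Complex.I * (u + (1 + ω) * Complex.I) * x))

/-- The operator `K[t]`: `(K[t] f)(x) = 1_{(-∞,t]}(x) ∫_{-∞}^t K(x+y) f(y) dy`. -/
def hankelOp (K : ℝ → ℂ) (t : ℝ) (f : ℝ → ℂ) (x : ℝ) : ℂ :=
  (Iic t).indicator (fun x => ∫ y in Iic t, K (x + y) * f y) x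

/-- The Fredholm determinant `det(1 + c T)` of the integral operator `T` with kernel `k` on
`L²(μ)`, by Fredholm's series `∑ cⁿ/n! ∫ ⋯ ∫ det (k(xᵢ, xⱼ)) dμ(x₁) ⋯ dμ(xₙ)`. -/
def fredholmDet (μ : Measure ℝ) (k : ℝ → ℝ → ℂ) (c : ℂ) : ℂ :=
  ∑' n : ℕ, c ^ n / (n.factorial : ℂ) *
    ∫ x : Fin n → ℝ, (Matrix.of fun i j => k (x i) (x j)).det ∂(Measure.pi fun _ => μ)

/-- `det(1 + c K[t])`, where `K[t]` acts on `L²(-∞,t)` with kernel `K(x+y)`. -/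
def hankelDet (K : ℝ → ℂ) (t : ℝ) (c : ℂ) : ℂ :=
  fredholmDet (volume.restrict (Iic t)) (fun x y => K (x + y)) c

/-- `m(t) = det(1 + K[t]) / det(1 - K[t])`. -/
def mFun (K : ℝ → ℂ) (t : ℝ) : ℂ := hankelDet K t 1 / hankelDet K t (-1)

/-- `f` represents an element of `L²(-∞,t)` which solves `(1 + c K[t]) f = g` in `L²(-∞,t)`,
i.e. almost everywhere. -/
def IsL2Solution (K : ℝ → ℂ) (t : ℝ) (c : ℂ) (g f : ℝ → ℂ) : Prop :=
  MemLp f 2 (volume.restrict (Iic t)) ∧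
    ∀ᵐ x ∂(volume.restrict (Iic t)), f x + c * hankelOp K t f x = g x

/-- `f` is in `L²(-∞,t)` and satisfies the integral equation `f + c K[t] f = g` at every point of
`(-∞,t]`. (This singles out one representative on `(-∞,t]` of an `L²`-solution.) -/
def IsSolution (K : ℝ → ℂ) (t : ℝ) (c : ℂ) (g f : ℝ → ℂ) : Prop :=
  MemLp f 2 (volume.restrict (Iic t)) ∧ ∀ x ≤ t, f x + c * hankelOp K t f x = g x

/-- Unique solvability of `(1 + c K[t]) f = g` in `L²(-∞,t)`: there is a pointwise solution, and
every `L²`-solution is almost everywhere equal to it. -/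
def UniquelySolvable (K : ℝ → ℂ) (t : ℝ) (c : ℂ) (g : ℝ → ℂ) : Prop :=
  ∃ f : ℝ → ℂ, IsSolution K t c g f ∧
    ∀ h : ℝ → ℂ, IsL2Solution K t c g h → h =ᵐ[volume.restrict (Iic t)] f

/-- The characteristic function of `[-t,t]`. -/
def charIcc (t : ℝ) : ℝ → ℂ := (Icc (-t) t).indicator (fun _ => 1)

end

/-! Write φ_c for the solution of (1 + cK[t])φ = K(· + t) and Φ_c for the solution with right side 1
on [-t,t]; then Φ = Φ_1, Ψ = Φ_{-1}, φ^± = φ_{±1}. Each assertion is proved once for general c and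
applied with c = 1 and c = -1. The only facts about ξ that enter are that K is continuous and
vanishes on (-∞,0]. They follow from the decay O(|a|^{-ων}), ων > 1, of the ξ-quotient on a
half-plane: it gives absolute convergence of the inversion integral and, by moving the contour to
infinity, K(0) = 0 (`xiKernel_continuous_and_eq_zero`). Since K(x+y) = 0 for x + y ≤ 0, the
half-line (-∞,t] may be cut at -T with T ≥ t, and K replaced by a bounded uniformly continuous
kernel. On a finite interval Fredholm's minors give an explicit inverse of 1 + cK on bounded
continuous functions when the determinant is nonzero (`isUnit_one_add_kernelOp`). Evaluation at a
point is continuous on that space, so pointwise formulas make sense. For the t-derivative,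
subtracting the equations at s and t yields ∂_t Φ_c = -cΦ_c(t,t)φ_c (`hasDerivWithinAt_hankelSol`).
For the x-derivative, K(x+y) has the same derivative in x and in y, so integration by parts turns c
into -c and 1 + c∫_x^t φ_{-c} solves the equation with a constant right side; hence ∂_x Φ_c =
-cΦ_c(t,t)φ_{-c} and Φ_c(t,t) ≠ 0 (`hankelSol_one_eq`). For the determinants, splitting Fredholm's
integrals by their largest variable gives d/dt log det(1 + cK[t]) = cφ_c(t,t), while d/dt log
Φ_c(t,t) = -c(φ_c(t,t) + φ_{-c}(t,t)), as right derivatives. Thus det(1 + cK[t])Φ_c(t,t)/det(1 -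
cK[t]) is constant, and it equals 1 at t = 0 (`truncDet_mul_hankelSol`). -/

open scoped BoundedContinuousFunction

/-! ### Hadamard's inequality and the convergent majorant of Fredholm's series. -/

open scoped ComplexOrder in
/-- Hadamard's inequality for a matrix with bounded entries. -/
theorem norm_det_sq_le {n : Type*} [Fintype n] [DecidableEq n] (A : Matrix n n ℂ) {M : ℝ}
    (h : ∀ i j, ‖A i j‖ ≤ M) :
    ‖A.det‖ ^ 2 ≤ (Fintype.card n * M ^ 2) ^ Fintype.card n := by
  classical
  rcases isEmpty_or_nonempty n with hn | hn
  · simp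
  -- The eigenvalues of A A* have product |det A|² and sum equal to the sum of all |A i j|², so the
  -- arithmetic-geometric mean inequality gives the bound.
  have hB : (A * A.conjTranspose).PosSemidef := Matrix.posSemidef_self_mul_conjTranspose A
  have hH := hB.isHermitian
  have h0 : ∀ i, 0 ≤ hH.eigenvalues i := fun i => hB.eigenvalues_nonneg i
  have hdet : ∏ i, hH.eigenvalues i = ‖A.det‖ ^ 2 := by
    have e := hH.det_eq_prod_eigenvalues
    rw [Matrix.det_mul, Matrix.det_conjTranspose, Complex.star_def, Complex.mul_conj,
      Complex.normSq_eq_norm_sq] at e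
    have e' : ((‖A.det‖ ^ 2 : ℝ) : ℂ) = ((∏ i, hH.eigenvalues i : ℝ) : ℂ) := by
      rw [e]; push_cast; rfl
    exact (Complex.ofReal_injective e').symm
  have htr : ∑ i, hH.eigenvalues i ≤ Fintype.card n * (Fintype.card n * M ^ 2) := by
    have e := hH.trace_eq_sum_eigenvalues
    have e2 : (A * A.conjTranspose).trace = ((∑ i, ∑ j, ‖A i j‖ ^ 2 : ℝ) : ℂ) := by
      simp only [Matrix.trace, Matrix.diag, Matrix.mul_apply, Matrix.conjTranspose_apply,
        Complex.star_def, Complex.mul_conj, Complex.normSq_eq_norm_sq]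
      push_cast; rfl
    have e3 : ((∑ i, ∑ j, ‖A i j‖ ^ 2 : ℝ) : ℂ) = ((∑ i, hH.eigenvalues i : ℝ) : ℂ) := by
      rw [← e2, e]; push_cast; rfl
    rw [← Complex.ofReal_injective e3]
    have : ∀ i j, ‖A i j‖ ^ 2 ≤ M ^ 2 := fun i j => by
      have := h i j; have := norm_nonneg (A i j); gcongr
    calc ∑ i, ∑ j, ‖A i j‖ ^ 2 ≤ ∑ _i : n, ∑ _j : n, M ^ 2 :=
          Finset.sum_le_sum fun i _ => Finset.sum_le_sum fun j _ => this i j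
      _ = _ := by simp
  have hc : (0 : ℝ) < Fintype.card n := by exact_mod_cast Fintype.card_pos
  have hcn : Fintype.card n ≠ 0 := Fintype.card_ne_zero
  have am := Real.geom_mean_le_arith_mean Finset.univ (fun _ : n => (1 : ℝ)) hH.eigenvalues
    (by simp) (by simpa using hc) (fun i _ => h0 i)
  simp only [Real.rpow_one, one_mul, Finset.sum_const, Finset.card_univ, nsmul_eq_mul, mul_one]
    at am
  rw [← hdet]
  have hp : 0 ≤ ∏ i, hH.eigenvalues i := Finset.prod_nonneg fun i _ => h0 i
  calc ∏ i, hH.eigenvalues i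
      = ((∏ i, hH.eigenvalues i) ^ ((Fintype.card n : ℝ)⁻¹)) ^ Fintype.card n := by
        rw [Real.rpow_inv_natCast_pow hp hcn]
    _ ≤ ((∑ i, hH.eigenvalues i) / Fintype.card n) ^ Fintype.card n := by
        gcongr
    _ ≤ _ := by
        have hs : 0 ≤ ∑ i, hH.eigenvalues i := Finset.sum_nonneg fun i _ => h0 i
        gcongr
        rw [div_le_iff₀ hc]; linarith

/-- The Hadamard bound for determinants of order `n` with entries bounded by `M`. -/
noncomputable def hadamardBound (M : ℝ) (n : ℕ) : ℝ := √((n * M ^ 2) ^ n)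

theorem hadamardBound_nonneg (M : ℝ) (n : ℕ) : 0 ≤ hadamardBound M n := Real.sqrt_nonneg _

theorem norm_det_le_hadamardBound {n : ℕ} (A : Matrix (Fin n) (Fin n) ℂ) {M : ℝ}
    (h : ∀ i j, ‖A i j‖ ≤ M) : ‖A.det‖ ≤ hadamardBound M n := by
  apply Real.le_sqrt_of_sq_le
  simpa using norm_det_sq_le A h

/-- Hadamard's bound grows like the square root of n! up to a geometric factor, so division by n!
leaves a convergent series. The square root is removed by 2pq ≤ p² + q² with weights L^n, leaving an
exponential and a geometric series. -/
theorem summable_hadamardBound (C M : ℝ) :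
    Summable fun n : ℕ => C ^ n / n.factorial * hadamardBound M (n + 1) := by
  set b : ℝ := Real.exp 1 * M ^ 2 with hb
  have hb0 : 0 ≤ b := by positivity
  -- Any L > 2b works: it makes the ratio 2b/L of the geometric series less than 1.
  set L : ℝ := 4 * b + 1 with hL
  have hL0 : 0 < L := by positivity
  have hX : ∀ n : ℕ, (((n + 1 : ℕ) : ℝ) * M ^ 2) ^ (n + 1) ≤ n.factorial * (b * (2 * b) ^ n) := by
    intro n
    have h1 := Real.pow_div_factorial_le_exp ((n + 1 : ℕ) : ℝ) (by positivity) (n + 1)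
    rw [div_le_iff₀ (by positivity)] at h1
    have h2 : Real.exp ((n + 1 : ℕ) : ℝ) = Real.exp 1 ^ (n + 1) := by
      rw [← Real.exp_nat_mul, mul_one]
    have h3 : ((n + 1 : ℕ) : ℝ) ≤ 2 ^ n := by exact_mod_cast Nat.lt_two_pow_self
    calc (((n + 1 : ℕ) : ℝ) * M ^ 2) ^ (n + 1)
        = ((n + 1 : ℕ) : ℝ) ^ (n + 1) * (M ^ 2) ^ (n + 1) := mul_pow _ _ _
      _ ≤ (Real.exp ((n + 1 : ℕ) : ℝ) * (n + 1).factorial) * (M ^ 2) ^ (n + 1) := by gcongr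
      _ = ((n + 1 : ℕ) : ℝ) * (n.factorial * b ^ (n + 1)) := by
          rw [h2, Nat.factorial_succ, hb, mul_pow]; push_cast; ring
      _ ≤ 2 ^ n * (n.factorial * b ^ (n + 1)) := by gcongr
      _ = _ := by rw [mul_pow]; ring
  have hs1 : Summable fun n : ℕ => (C ^ 2 * L) ^ n / n.factorial :=
    Real.summable_pow_div_factorial _
  have hs2 : Summable fun n : ℕ => b * (2 * b / L) ^ n := by
    refine (summable_geometric_of_lt_one (by positivity) ?_).mul_left b
    rw [div_lt_one hL0]; linarith
  refine Summable.of_norm_bounded (hs1.add hs2) fun n => ?_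
  set X : ℝ := (((n + 1 : ℕ) : ℝ) * M ^ 2) ^ (n + 1) with hXdef
  have hX0 : 0 ≤ X := by positivity
  have hLn : 0 < L ^ n := by positivity
  have key : |C| ^ n * √X ≤ (C ^ 2 * L) ^ n + X / L ^ n := by
    have h1 := sq_nonneg (|C| ^ n * √(L ^ n) - √X / √(L ^ n))
    have h2 : √(L ^ n) ≠ 0 := (Real.sqrt_pos.2 hLn).ne'
    have e : (|C| ^ n * √(L ^ n) - √X / √(L ^ n)) ^ 2
        = (C ^ 2 * L) ^ n + X / L ^ n - 2 * (|C| ^ n * √X) := by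
      have e1 : √X ^ 2 = X := Real.sq_sqrt hX0
      have e2 : √(L ^ n) ^ 2 = L ^ n := Real.sq_sqrt hLn.le
      have e3 : (|C| ^ n) ^ 2 = (C ^ 2) ^ n := by rw [← pow_mul, mul_comm n 2, pow_mul, sq_abs]
      rw [sub_sq, mul_pow, div_pow, e1, e2, e3, mul_pow]
      field_simp
      ring
    have h3 : 0 ≤ |C| ^ n * √X := by positivity
    linarith
  rw [norm_mul, norm_div, norm_pow, Real.norm_eq_abs, Real.norm_eq_abs, Real.norm_eq_abs,
    abs_of_nonneg (hadamardBound_nonneg _ _), Nat.abs_cast, hadamardBound, div_mul_eq_mul_div,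
    div_le_iff₀ (by positivity), add_mul, div_mul_cancel₀ _ (by positivity)]
  refine key.trans ?_
  gcongr
  rw [div_le_iff₀ hLn]
  calc X ≤ _ := hX n
    _ = _ := by rw [div_pow]; field_simp

/-! ### Fredholm's minors and their recursion. -/

section Fredholm

variable (μ : Measure ℝ)

/-- The matrix `(k (xᵢ, yⱼ))`. -/
def kernelMatrix (k : ℝ × ℝ → ℂ) {n : ℕ} (x y : Fin n → ℝ) : Matrix (Fin n) (Fin n) ℂ :=
  Matrix.of fun i j => k (x i, y j)

theorem continuous_det_kernelMatrix (k : (ℝ × ℝ) →ᵇ ℂ) (n : ℕ) :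
    Continuous fun p : (Fin n → ℝ) × (Fin n → ℝ) => (kernelMatrix k p.1 p.2).det := by
  refine Continuous.matrix_det (continuous_matrix fun i j => ?_)
  exact k.continuous.comp (by fun_prop)

theorem norm_det_kernelMatrix_le (k : (ℝ × ℝ) →ᵇ ℂ) {n : ℕ} (x y : Fin n → ℝ) :
    ‖(kernelMatrix k x y).det‖ ≤ hadamardBound ‖k‖ n :=
  norm_det_le_hadamardBound _ fun _ _ => k.norm_coe_le_norm _

theorem det_kernelMatrix_comp_perm (k : ℝ × ℝ → ℂ) {n : ℕ} (x y : Fin n → ℝ)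
    (σ : Equiv.Perm (Fin n)) :
    (kernelMatrix k (x ∘ σ) y).det = Equiv.Perm.sign σ * (kernelMatrix k x y).det := by
  rw [← Matrix.det_permute]; rfl

theorem det_kernelMatrix_comp_perm_both (k : ℝ × ℝ → ℂ) {n : ℕ} (x : Fin n → ℝ)
    (σ : Equiv.Perm (Fin n)) :
    (kernelMatrix k (x ∘ σ) (x ∘ σ)).det = (kernelMatrix k x x).det := by
  rw [← Matrix.det_submatrix_equiv_self σ (kernelMatrix k x x)]; rfl

/-- Expansion of a bordered determinant along its first row. -/
theorem det_kernelMatrix_cons_cons (k : ℝ × ℝ → ℂ) {n : ℕ} (x y : ℝ) (w : Fin (n + 1) → ℝ) :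
    (kernelMatrix k (Fin.cons x w : Fin (n + 2) → ℝ) (Fin.cons y w)).det =
      k (x, y) * (kernelMatrix k w w).det -
        ∑ j : Fin (n + 1), k (x, w j) *
          (kernelMatrix k (Fin.cons (w j) (j.removeNth w) : Fin (n + 1) → ℝ)
            (Fin.cons y (j.removeNth w))).det := by
  rw [Matrix.det_succ_row_zero, Fin.sum_univ_succ, sub_eq_add_neg, ← Finset.sum_neg_distrib]
  congr 1
  · have : ((kernelMatrix k (Fin.cons x w : Fin (n + 2) → ℝ) (Fin.cons y w)).submatrix Fin.succ
        (Fin.succAbove 0)) = kernelMatrix k w w := by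
      ext i j; simp [kernelMatrix]
    rw [this]; simp [kernelMatrix]
  · refine Finset.sum_congr rfl fun j _ => ?_
    have h1 : ((kernelMatrix k (Fin.cons x w : Fin (n + 2) → ℝ) (Fin.cons y w)).submatrix Fin.succ
        (Fin.succAbove j.succ)) = kernelMatrix k w (Fin.cons y (j.removeNth w)) := by
      ext a b
      refine Fin.cases ?_ (fun b => ?_) b
      · simp [kernelMatrix]
      · simp [kernelMatrix, Fin.removeNth]
    rw [h1]
    -- Moving row j to the front costs the sign (-1)^j, which with the cofactor sign (-1)^(j+1)
    -- leaves -1 for every j.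
    have h2 : (Fin.cons (w j) (j.removeNth w) : Fin (n + 1) → ℝ) = w ∘ j.cycleRange.symm := by
      exact Fin.cons_removeNth_eq_comp_cycleRange_symm w j
    rw [h2, det_kernelMatrix_comp_perm]
    simp [kernelMatrix, Fin.sign_cycleRange, pow_succ]
    ring_nf

/-- Integrated minors of Fredholm's theory. -/
noncomputable def minorIntegral (k : ℝ × ℝ → ℂ) (n : ℕ) (p : ℝ × ℝ) : ℂ :=
  ∫ w : Fin n → ℝ, (kernelMatrix k (Fin.cons p.1 w : Fin (n + 1) → ℝ) (Fin.cons p.2 w)).det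
    ∂(Measure.pi fun _ => μ)

/-- The integrals of Fredholm's series. -/
noncomputable def detIntegral (k : ℝ × ℝ → ℂ) (n : ℕ) : ℂ :=
  ∫ w : Fin n → ℝ, (kernelMatrix k w w).det ∂(Measure.pi fun _ => μ)

variable [IsFiniteMeasure μ]

theorem integrable_of_continuous_bounded {α : Type*} [TopologicalSpace α] [MeasurableSpace α]
    [OpensMeasurableSpace α] {ν : Measure α} [IsFiniteMeasure ν] [SecondCountableTopology α] {f : α → ℂ} (hf : Continuous f)
    {C : ℝ} (hC : ∀ x, ‖f x‖ ≤ C) : Integrable f ν :=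
  Integrable.of_bound hf.aestronglyMeasurable C (Eventually.of_forall hC)

theorem norm_minorIntegral_le (k : (ℝ × ℝ) →ᵇ ℂ) (n : ℕ) (p : ℝ × ℝ) :
    ‖minorIntegral μ k n p‖ ≤ hadamardBound ‖k‖ (n + 1) * μ.real univ ^ n := by
  refine (norm_integral_le_of_norm_le_const
    (Eventually.of_forall fun w => norm_det_kernelMatrix_le k _ _)).trans_eq ?_
  simp [Measure.real, Measure.pi_univ]

theorem norm_detIntegral_le (k : (ℝ × ℝ) →ᵇ ℂ) (n : ℕ) :
    ‖detIntegral μ k n‖ ≤ hadamardBound ‖k‖ n * μ.real univ ^ n := by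
  refine (norm_integral_le_of_norm_le_const
    (Eventually.of_forall fun w => norm_det_kernelMatrix_le k _ _)).trans_eq ?_
  simp [Measure.real, Measure.pi_univ]

theorem continuous_cons (n : ℕ) :
    Continuous fun p : ℝ × (Fin n → ℝ) => (Fin.cons p.1 p.2 : Fin (n + 1) → ℝ) := by
  refine continuous_pi fun i => ?_
  refine Fin.cases ?_ (fun i => ?_) i
  · simpa using continuous_fst
  · simpa using (by fun_prop : Continuous fun p : ℝ × (Fin n → ℝ) => p.2 i)

theorem continuous_minorIntegral (k : (ℝ × ℝ) →ᵇ ℂ) (n : ℕ) :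
    Continuous (minorIntegral μ k n) := by
  have hc : Continuous fun q : (ℝ × ℝ) × (Fin n → ℝ) =>
      (kernelMatrix k (Fin.cons q.1.1 q.2 : Fin (n + 1) → ℝ) (Fin.cons q.1.2 q.2)).det :=
    (continuous_det_kernelMatrix k (n + 1)).comp
      (((continuous_cons n).comp (by fun_prop : Continuous fun q : (ℝ × ℝ) × (Fin n → ℝ) =>
        (q.1.1, q.2))).prodMk ((continuous_cons n).comp
        (by fun_prop : Continuous fun q : (ℝ × ℝ) × (Fin n → ℝ) => (q.1.2, q.2))))
  refine continuous_of_dominated (bound := fun _ => hadamardBound ‖k‖ (n + 1))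
    (fun p => (hc.comp (by fun_prop : Continuous fun w => (p, w))).aestronglyMeasurable)
    (fun p => Eventually.of_forall fun w => norm_det_kernelMatrix_le k _ _)
    (integrable_const _) (Eventually.of_forall fun w => ?_)
  exact hc.comp (by fun_prop : Continuous fun p => (p, w))

/-- Splitting off the `j`-th variable in an integral over a power of `μ`. -/
theorem integral_pi_removeNth {n : ℕ} (j : Fin (n + 1)) (g : ℝ → (Fin n → ℝ) → ℂ)
    (hg : Integrable (fun q : ℝ × (Fin n → ℝ) => g q.1 q.2) (μ.prod (Measure.pi fun _ => μ))) :
    ∫ w : Fin (n + 1) → ℝ, g (w j) (j.removeNth w) ∂(Measure.pi fun _ => μ) =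
      ∫ z, ∫ v, g z v ∂(Measure.pi fun _ => μ) ∂μ := by
  rw [← integral_prod (fun q : ℝ × (Fin n → ℝ) => g q.1 q.2) hg]
  exact (measurePreserving_piFinSuccAbove (fun _ => μ) j).integral_comp'
    (fun q : ℝ × (Fin n → ℝ) => g q.1 q.2)

theorem integrable_pi_removeNth {n : ℕ} (j : Fin (n + 1)) (g : ℝ → (Fin n → ℝ) → ℂ)
    (hg : Integrable (fun q : ℝ × (Fin n → ℝ) => g q.1 q.2) (μ.prod (Measure.pi fun _ => μ))) :
    Integrable (fun w : Fin (n + 1) → ℝ => g (w j) (j.removeNth w)) (Measure.pi fun _ => μ) :=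
  (measurePreserving_piFinSuccAbove (fun _ => μ) j).integrable_comp_of_integrable hg

/-- In the expansion along the first row, the n + 1 off-diagonal terms differ only in the name of
the variable paired with x; after integration they coincide, whence the factor n + 1. -/
theorem minorIntegral_succ (k : (ℝ × ℝ) →ᵇ ℂ) (n : ℕ) (x y : ℝ) :
    minorIntegral μ k (n + 1) (x, y) =
      k (x, y) * detIntegral μ k (n + 1) -
        (n + 1) * ∫ z, k (x, z) * minorIntegral μ k n (z, y) ∂μ := by
  have hc : Continuous fun q : ℝ × (Fin n → ℝ) => k (x, q.1) *
      (kernelMatrix k (Fin.cons q.1 q.2 : Fin (n + 1) → ℝ) (Fin.cons y q.2)).det := by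
    refine (k.continuous.comp (by fun_prop)).mul ?_
    exact (continuous_det_kernelMatrix k (n + 1)).comp ((continuous_cons n).prodMk
      ((continuous_cons n).comp (by fun_prop : Continuous fun q : ℝ × (Fin n → ℝ) => (y, q.2))))
  have hi : Integrable (fun q : ℝ × (Fin n → ℝ) => k (x, q.1) *
      (kernelMatrix k (Fin.cons q.1 q.2 : Fin (n + 1) → ℝ) (Fin.cons y q.2)).det)
      (μ.prod (Measure.pi fun _ => μ)) := by
    refine integrable_of_continuous_bounded hc (C := ‖k‖ * hadamardBound ‖k‖ (n + 1)) fun q => ?_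
    rw [norm_mul]
    gcongr
    · exact k.norm_coe_le_norm _
    · exact norm_det_kernelMatrix_le _ _ _
  have hw : Integrable (fun w : Fin (n + 1) → ℝ => (kernelMatrix k w w).det)
      (Measure.pi fun _ => μ) :=
    integrable_of_continuous_bounded
      ((continuous_det_kernelMatrix k (n + 1)).comp (by fun_prop : Continuous fun w => (w, w)))
      fun w => norm_det_kernelMatrix_le k w w
  have hj := fun j : Fin (n + 1) => integrable_pi_removeNth μ j (fun z v => k (x, z) *
      (kernelMatrix k (Fin.cons z v : Fin (n + 1) → ℝ) (Fin.cons y v)).det) hi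
  have ej := fun j : Fin (n + 1) => integral_pi_removeNth μ j (fun z v => k (x, z) *
      (kernelMatrix k (Fin.cons z v : Fin (n + 1) → ℝ) (Fin.cons y v)).det) hi
  simp only [minorIntegral, det_kernelMatrix_cons_cons]
  rw [integral_sub (hw.const_mul _) (integrable_finsetSum _ fun j _ => hj j),
    integral_finsetSum _ fun j _ => hj j, Finset.sum_congr rfl fun j _ => ej j,
    integral_const_mul]
  simp [integral_const_mul, detIntegral]

omit [IsFiniteMeasure μ] in
theorem minorIntegral_symm (k : (ℝ × ℝ) →ᵇ ℂ) (hk : ∀ x y, k (x, y) = k (y, x)) (n : ℕ) (x y : ℝ) :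
    minorIntegral μ k n (x, y) = minorIntegral μ k n (y, x) := by
  simp only [minorIntegral]
  congr 1 with w
  rw [← Matrix.det_transpose]
  congr 1
  ext i j
  simp [kernelMatrix, hk]

end Fredholm

/-! ### Integral operators on bounded continuous functions and Fredholm's inverse. -/

section Fredholm

variable (μ : Measure ℝ) [IsFiniteMeasure μ]

/-- The integral operator with kernel `k`, applied to an integrable function. -/
noncomputable def kernelApply (k : (ℝ × ℝ) →ᵇ ℂ) (h : ℝ → ℂ) (hh : Integrable h μ) : ℝ →ᵇ ℂ :=
  BoundedContinuousFunction.ofNormedAddCommGroup (fun x => ∫ y, k (x, y) * h y ∂μ)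
    (by
      refine continuous_of_dominated (bound := fun y => ‖k‖ * ‖h y‖) (fun x => ?_) (fun x => ?_)
        (hh.norm.const_mul _) (Eventually.of_forall fun y => ?_)
      · exact (k.continuous.comp (by fun_prop)).aestronglyMeasurable.mul hh.aestronglyMeasurable
      · refine Eventually.of_forall fun y => ?_
        rw [norm_mul]; gcongr; exact k.norm_coe_le_norm _
      · exact (k.continuous.comp (by fun_prop)).mul continuous_const)
    (‖k‖ * ∫ y, ‖h y‖ ∂μ)
    (fun x => by
      rw [← integral_const_mul]
      refine norm_integral_le_of_norm_le (hh.norm.const_mul _) (Eventually.of_forall fun y => ?_)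
      rw [norm_mul]; gcongr; exact k.norm_coe_le_norm _)

omit [IsFiniteMeasure μ] in
@[simp] theorem kernelApply_apply (k : (ℝ × ℝ) →ᵇ ℂ) (h : ℝ → ℂ) (hh : Integrable h μ) (x : ℝ) :
    kernelApply μ k h hh x = ∫ y, k (x, y) * h y ∂μ := rfl

theorem integrable_bcf (f : ℝ →ᵇ ℂ) : Integrable f μ :=
  integrable_of_continuous_bounded f.continuous f.norm_coe_le_norm

theorem integrable_kernel_mul (k : (ℝ × ℝ) →ᵇ ℂ) (f : ℝ →ᵇ ℂ) (x : ℝ) :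
    Integrable (fun y => k (x, y) * f y) μ := by
  refine integrable_of_continuous_bounded
    ((k.continuous.comp (by fun_prop)).mul f.continuous) (C := ‖k‖ * ‖f‖) fun y => ?_
  rw [norm_mul]
  gcongr
  · exact k.norm_coe_le_norm _
  · exact f.norm_coe_le_norm _

theorem integrable_kernel_mul_kernel (k r : (ℝ × ℝ) →ᵇ ℂ) (x y : ℝ) :
    Integrable (fun z => k (x, z) * r (z, y)) μ := by
  refine integrable_of_continuous_bounded
    ((k.continuous.comp (by fun_prop)).mul (r.continuous.comp (by fun_prop)))
    (C := ‖k‖ * ‖r‖) fun y => ?_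
  rw [norm_mul]
  gcongr
  · exact k.norm_coe_le_norm _
  · exact r.norm_coe_le_norm _

/-- The integral operator with kernel `k` on bounded continuous functions. -/
noncomputable def kernelOp (k : (ℝ × ℝ) →ᵇ ℂ) : (ℝ →ᵇ ℂ) →L[ℂ] (ℝ →ᵇ ℂ) :=
  LinearMap.mkContinuous
    { toFun := fun f => kernelApply μ k f (integrable_bcf μ f)
      map_add' := fun f g => by
        ext x
        simp only [kernelApply_apply, BoundedContinuousFunction.coe_add, Pi.add_apply, mul_add]
        exact integral_add (integrable_kernel_mul μ k f x) (integrable_kernel_mul μ k g x)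
      map_smul' := fun c f => by
        ext x
        simp only [kernelApply_apply, BoundedContinuousFunction.coe_smul, smul_eq_mul,
          RingHom.id_apply, ← integral_const_mul]
        congr 1 with y; ring }
    (‖k‖ * μ.real univ)
    (fun f => by
      refine (BoundedContinuousFunction.norm_le (by positivity)).2 fun x => ?_
      refine (norm_integral_le_of_norm_le_const (C := ‖k‖ * ‖f‖)
        (Eventually.of_forall fun y => ?_)).trans_eq (by ring)
      rw [norm_mul]
      gcongr
      · exact k.norm_coe_le_norm _
      · exact f.norm_coe_le_norm _)

@[simp] theorem kernelOp_apply (k : (ℝ × ℝ) →ᵇ ℂ) (f : ℝ →ᵇ ℂ) (x : ℝ) :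
    kernelOp μ k f x = ∫ y, k (x, y) * f y ∂μ := rfl

/-- Composition of kernels `∫ k (x, z) r (z, y) dμ(z)`. -/
noncomputable def kernelComp (k : (ℝ × ℝ) →ᵇ ℂ) : ((ℝ × ℝ) →ᵇ ℂ) →L[ℂ] ((ℝ × ℝ) →ᵇ ℂ) :=
  have hb : ∀ (r : (ℝ × ℝ) →ᵇ ℂ) (x y z : ℝ), ‖k (x, z) * r (z, y)‖ ≤ ‖k‖ * ‖r‖ :=
    fun r x y z => by
      rw [norm_mul]
      gcongr
      · exact k.norm_coe_le_norm _
      · exact r.norm_coe_le_norm _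
  have hB : ∀ (r : (ℝ × ℝ) →ᵇ ℂ) (p : ℝ × ℝ),
      ‖∫ z, k (p.1, z) * r (z, p.2) ∂μ‖ ≤ ‖k‖ * μ.real univ * ‖r‖ := fun r p =>
    (norm_integral_le_of_norm_le_const (Eventually.of_forall fun z => hb r _ _ z)).trans_eq
      (by ring)
  LinearMap.mkContinuous
    { toFun := fun r => BoundedContinuousFunction.ofNormedAddCommGroup
        (fun p => ∫ z, k (p.1, z) * r (z, p.2) ∂μ)
        (by
          refine continuous_of_dominated (bound := fun _ => ‖k‖ * ‖r‖) (fun p => ?_) (fun p => ?_)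
            (integrable_const _) (Eventually.of_forall fun z => ?_)
          · exact (integrable_kernel_mul_kernel μ k r _ _).aestronglyMeasurable
          · exact Eventually.of_forall fun z => hb r _ _ z
          · exact (k.continuous.comp (by fun_prop)).mul (r.continuous.comp (by fun_prop)))
        (‖k‖ * μ.real univ * ‖r‖) (hB r)
      map_add' := fun f g => by
        ext p
        simp only [BoundedContinuousFunction.coe_ofNormedAddCommGroup,
          BoundedContinuousFunction.coe_add, Pi.add_apply, mul_add]
        exact integral_add (integrable_kernel_mul_kernel μ k f _ _)
          (integrable_kernel_mul_kernel μ k g _ _)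
      map_smul' := fun c f => by
        ext p
        simp only [BoundedContinuousFunction.coe_ofNormedAddCommGroup,
          BoundedContinuousFunction.coe_smul, smul_eq_mul,
          RingHom.id_apply, ← integral_const_mul]
        congr 1 with y; ring }
    (‖k‖ * μ.real univ)
    (fun r => (BoundedContinuousFunction.norm_le (by positivity)).2 fun p => hB r p)

@[simp] theorem kernelComp_apply (k r : (ℝ × ℝ) →ᵇ ℂ) (p : ℝ × ℝ) :
    kernelComp μ k r p = ∫ z, k (p.1, z) * r (z, p.2) ∂μ := rfl

theorem kernelOp_add (k r : (ℝ × ℝ) →ᵇ ℂ) : kernelOp μ (k + r) = kernelOp μ k + kernelOp μ r := by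
  ext f x
  simp only [kernelOp_apply, BoundedContinuousFunction.coe_add, Pi.add_apply, add_mul,
    add_apply]
  exact integral_add (integrable_kernel_mul μ k f x) (integrable_kernel_mul μ r f x)

theorem kernelOp_smul (c : ℂ) (k : (ℝ × ℝ) →ᵇ ℂ) : kernelOp μ (c • k) = c • kernelOp μ k := by
  ext f x
  simp only [kernelOp_apply, BoundedContinuousFunction.coe_smul, smul_eq_mul,
    smul_apply, mul_assoc, integral_const_mul]

/-- By Fubini, composition of kernels is composition of operators; this transfers Fredholm's
identities from kernels to operators. -/
theorem kernelOp_kernelComp (k r : (ℝ × ℝ) →ᵇ ℂ) :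
    kernelOp μ (kernelComp μ k r) = kernelOp μ k * kernelOp μ r := by
  ext f x
  simp only [kernelOp_apply, kernelComp_apply, mul_apply_eq_comp,
    ← integral_mul_const, ← integral_const_mul]
  rw [integral_integral_swap]
  · congr 1 with y; congr 1 with z; ring
  · refine integrable_of_continuous_bounded (C := ‖k‖ * ‖r‖ * ‖f‖)
      (((k.continuous.comp (by fun_prop)).mul (r.continuous.comp (by fun_prop))).mul
        (f.continuous.comp (by fun_prop))) fun q => ?_
    simp only [Function.uncurry, norm_mul]
    gcongr
    · exact k.norm_coe_le_norm _
    · exact r.norm_coe_le_norm _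
    · exact f.norm_coe_le_norm _

/-- The integrated Fredholm minors as bounded continuous functions. -/
noncomputable def minorKernel (k : (ℝ × ℝ) →ᵇ ℂ) (n : ℕ) : (ℝ × ℝ) →ᵇ ℂ :=
  BoundedContinuousFunction.ofNormedAddCommGroup (minorIntegral μ k n)
    (continuous_minorIntegral μ k n) _ (norm_minorIntegral_le μ k n)

@[simp] theorem minorKernel_apply (k : (ℝ × ℝ) →ᵇ ℂ) (n : ℕ) (p : ℝ × ℝ) :
    minorKernel μ k n p = minorIntegral μ k n p := rfl

theorem norm_minorKernel_le (k : (ℝ × ℝ) →ᵇ ℂ) (n : ℕ) :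
    ‖minorKernel μ k n‖ ≤ hadamardBound ‖k‖ (n + 1) * μ.real univ ^ n :=
  (BoundedContinuousFunction.norm_le
    (mul_nonneg (hadamardBound_nonneg _ _) (by positivity))).2 (norm_minorIntegral_le μ k n)

theorem norm_minor_term_le (k : (ℝ × ℝ) →ᵇ ℂ) (c : ℂ) (n : ℕ) :
    ‖(c ^ n / (n.factorial : ℂ)) • minorKernel μ k n‖ ≤
      (‖c‖ * μ.real univ) ^ n / n.factorial * hadamardBound ‖k‖ (n + 1) := by
  rw [norm_smul, norm_div, norm_pow, Complex.norm_natCast]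
  calc _ ≤ ‖c‖ ^ n / n.factorial * (hadamardBound ‖k‖ (n + 1) * μ.real univ ^ n) := by
        gcongr; exact norm_minorKernel_le μ k n
    _ = _ := by rw [mul_pow]; ring

theorem summable_minor_terms (k : (ℝ × ℝ) →ᵇ ℂ) (c : ℂ) :
    Summable fun n : ℕ => (c ^ n / (n.factorial : ℂ)) • minorKernel μ k n :=
  Summable.of_norm_bounded (summable_hadamardBound (‖c‖ * μ.real univ) ‖k‖)
    (norm_minor_term_le μ k c)

/-- Fredholm's first minor `∑ cⁿ/n! ∫ ⋯ ∫ det`. -/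
noncomputable def fredholmMinor (k : (ℝ × ℝ) →ᵇ ℂ) (c : ℂ) : (ℝ × ℝ) →ᵇ ℂ :=
  ∑' n : ℕ, (c ^ n / (n.factorial : ℂ)) • minorKernel μ k n

theorem hasSum_fredholmMinor (k : (ℝ × ℝ) →ᵇ ℂ) (c : ℂ) :
    HasSum (fun n : ℕ => (c ^ n / (n.factorial : ℂ)) • minorKernel μ k n)
      (fredholmMinor μ k c) :=
  (summable_minor_terms μ k c).hasSum

theorem hasSum_fredholmMinor_apply (k : (ℝ × ℝ) →ᵇ ℂ) (c : ℂ) (p : ℝ × ℝ) :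
    HasSum (fun n : ℕ => c ^ n / (n.factorial : ℂ) * minorIntegral μ k n p)
      (fredholmMinor μ k c p) :=
  (hasSum_fredholmMinor μ k c).mapL (BoundedContinuousFunction.evalCLM ℂ p)

theorem summable_det_terms (k : (ℝ × ℝ) →ᵇ ℂ) (c : ℂ) :
    Summable fun n : ℕ => c ^ n / (n.factorial : ℂ) * detIntegral μ k n := by
  rw [← summable_nat_add_iff 1]
  refine Summable.of_norm_bounded
    ((summable_hadamardBound (‖c‖ * μ.real univ) ‖k‖).mul_left (‖c‖ * μ.real univ)) fun n => ?_
  rw [norm_mul, norm_div, norm_pow, Complex.norm_natCast]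
  have h1 := norm_detIntegral_le μ k (n + 1)
  have h2 : (n.factorial : ℝ) ≤ (n + 1).factorial := by
    exact_mod_cast Nat.factorial_le (Nat.le_succ n)
  have h3 := hadamardBound_nonneg ‖k‖ (n + 1)
  calc _ ≤ ‖c‖ ^ (n + 1) / n.factorial * (hadamardBound ‖k‖ (n + 1) * μ.real univ ^ (n + 1)) := by
        gcongr
    _ = _ := by rw [mul_pow]; ring

theorem hasSum_fredholmDet (k : (ℝ × ℝ) →ᵇ ℂ) (c : ℂ) :
    HasSum (fun n : ℕ => c ^ n / (n.factorial : ℂ) * detIntegral μ k n)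
      (fredholmDet μ (fun x y => k (x, y)) c) :=
  (summable_det_terms μ k c).hasSum

/-- Fredholm's identity for the first minor. -/
theorem fredholmMinor_add_comp (k : (ℝ × ℝ) →ᵇ ℂ) (c : ℂ) :
    fredholmMinor μ k c + c • kernelComp μ k (fredholmMinor μ k c) =
      fredholmDet μ (fun x y => k (x, y)) c • k := by
  have hR := hasSum_fredholmMinor μ k c
  have hC := (hR.mapL (kernelComp μ k)).const_smul c
  have hD := (hasSum_fredholmDet μ k c).smul_const k
  rw [hasSum_nat_add_iff' 1 |>.symm] at hR hD
  simp only [map_smul] at hC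
  have hE := hR.add hC
  -- The minor of order n + 1 is paired with the composition of order n: by `minorIntegral_succ` the
  -- integral terms cancel and only the determinant coefficient remains.
  have e : ∀ n : ℕ, (c ^ (n + 1) / ((n + 1).factorial : ℂ)) • minorKernel μ k (n + 1) +
      c • (c ^ n / (n.factorial : ℂ)) • kernelComp μ k (minorKernel μ k n) =
      (c ^ (n + 1) / ((n + 1).factorial : ℂ) * detIntegral μ k (n + 1)) • k := by
    intro n
    ext p
    obtain ⟨x, y⟩ := p
    have h1 : (n.factorial : ℂ) ≠ 0 := by exact_mod_cast n.factorial_ne_zero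
    have h2 : (n : ℂ) + 1 ≠ 0 := by exact_mod_cast n.succ_ne_zero
    simp only [BoundedContinuousFunction.coe_add, BoundedContinuousFunction.coe_smul,
      Pi.add_apply, minorKernel_apply, minorIntegral_succ, kernelComp_apply, smul_eq_mul,
      Nat.factorial_succ]
    push_cast
    field_simp
    ring
  rw [show (fun n : ℕ => _) = fun n : ℕ => _ from funext e] at hE
  have := hE.unique hD
  -- The order-zero terms, split off by the index shift, are k on both sides.
  have z : (minorKernel μ k 0 : (ℝ × ℝ) →ᵇ ℂ) = detIntegral μ k 0 • k := by
    ext p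
    simp [minorIntegral, detIntegral, kernelMatrix]
  simp only [Finset.sum_range_one, pow_zero, Nat.factorial_zero, Nat.cast_one, div_one, one_smul,
    one_mul, z] at this
  rw [sub_add_eq_add_sub, sub_left_inj] at this
  exact this

theorem fredholmMinor_symm (k : (ℝ × ℝ) →ᵇ ℂ) (hk : ∀ x y, k (x, y) = k (y, x)) (c : ℂ) (x y : ℝ) :
    fredholmMinor μ k c (x, y) = fredholmMinor μ k c (y, x) := by
  have h := hasSum_fredholmMinor_apply μ k c (x, y)
  simp only [minorIntegral_symm μ k hk _ x y] at h
  exact h.unique (hasSum_fredholmMinor_apply μ k c (y, x))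

/-- For a symmetric kernel the minor is symmetric too, so interchanging x and y reverses the order
of composition. This supplies the inverse on the other side. -/
theorem fredholmMinor_add_comp' (k : (ℝ × ℝ) →ᵇ ℂ) (hk : ∀ x y, k (x, y) = k (y, x)) (c : ℂ) :
    fredholmMinor μ k c + c • kernelComp μ (fredholmMinor μ k c) k =
      fredholmDet μ (fun x y => k (x, y)) c • k := by
  ext p
  obtain ⟨x, y⟩ := p
  have h := DFunLike.congr_fun (fredholmMinor_add_comp μ k c) (y, x)
  simp only [BoundedContinuousFunction.coe_add, BoundedContinuousFunction.coe_smul,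
      Pi.add_apply, kernelComp_apply, smul_eq_mul] at h ⊢
  rw [fredholmMinor_symm μ k hk, hk x y, ← h]
  congr 2
  congr 1 with z
  rw [hk z y, fredholmMinor_symm μ k hk c x z, mul_comm]

/-- A symmetric kernel whose Fredholm determinant does not vanish gives an invertible operator. -/
theorem isUnit_one_add_kernelOp (k : (ℝ × ℝ) →ᵇ ℂ) (hk : ∀ x y, k (x, y) = k (y, x)) (c : ℂ)
    (hD : fredholmDet μ (fun x y => k (x, y)) c ≠ 0) : IsUnit (1 + c • kernelOp μ k) := by
  set D := fredholmDet μ (fun x y => k (x, y)) c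
  set R := fredholmMinor μ k c
  have h1 := congrArg (kernelOp μ) (fredholmMinor_add_comp μ k c)
  have h2 := congrArg (kernelOp μ) (fredholmMinor_add_comp' μ k hk c)
  simp only [kernelOp_add, kernelOp_smul, kernelOp_kernelComp] at h1 h2
  have e : (c / D) • D • kernelOp μ k = c • kernelOp μ k := by
    rw [smul_smul, div_mul_cancel₀ _ hD]
  have m1 : ∀ (a : ℂ) (A B : (ℝ →ᵇ ℂ) →L[ℂ] (ℝ →ᵇ ℂ)), a • A * B = a • (A * B) :=
    fun _ _ _ => rfl
  have m2 : ∀ (a : ℂ) (A B : (ℝ →ᵇ ℂ) →L[ℂ] (ℝ →ᵇ ℂ)), A * a • B = a • (A * B) :=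
    fun a A B => ContinuousLinearMap.ext fun f => A.map_smul a (B f)
  -- The inverse is 1 - (c/D)R: Fredholm's identity R + cKR = D K makes the product with 1 + cK
  -- collapse to 1.
  refine ⟨⟨1 + c • kernelOp μ k, 1 - (c / D) • kernelOp μ R, ?_, ?_⟩, rfl⟩
  · rw [← h1, smul_add] at e
    rw [mul_sub, mul_one, m2, add_mul, one_mul, m1, smul_add, e, add_sub_cancel_right]
  · rw [← h2, smul_add] at e
    rw [sub_mul, one_mul, m1, mul_add, mul_one, m2, smul_add, e, add_sub_cancel_right]

end Fredholm

/-! ### The determinant on (a,t] as an integral of diagonal minors. -/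

theorem pi_restrict_eq {n : ℕ} (S : Set ℝ) :
    (Measure.pi fun _ : Fin n => (volume : Measure ℝ).restrict S) =
      (volume : Measure (Fin n → ℝ)).restrict (univ.pi fun _ => S) := by
  rw [volume_pi, Measure.restrict_pi_pi]

/-- The hyperplanes on which two coordinates agree are null, so the largest coordinate is almost
surely attained only once. -/
theorem ae_injective_pi_restrict {n : ℕ} (S : Set ℝ) :
    ∀ᵐ w ∂(Measure.pi fun _ : Fin n => (volume : Measure ℝ).restrict S), Function.Injective w := by
  rw [pi_restrict_eq]
  refine ae_restrict_of_ae ?_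
  have h : ∀ i j : Fin n, i ≠ j → ∀ᵐ w : Fin n → ℝ, w i ≠ w j := by
    intro i j hij
    let p : Submodule ℝ (Fin n → ℝ) :=
      LinearMap.ker ((LinearMap.proj i : (Fin n → ℝ) →ₗ[ℝ] ℝ) - LinearMap.proj j)
    have hp : p ≠ ⊤ := by
      intro h
      have : (Pi.single i 1 : Fin n → ℝ) ∈ p := h ▸ Submodule.mem_top
      simp [p, hij.symm] at this
    have := Measure.addHaar_submodule (volume : Measure (Fin n → ℝ)) p hp
    rw [ae_iff]
    refine measure_mono_null (fun w hw => ?_) this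
    simpa [p, sub_eq_zero] using hw
  have h' : ∀ᵐ w : Fin n → ℝ, ∀ i j : Fin n, i ≠ j → w i ≠ w j := by
    simp only [ae_all_iff]
    exact h
  filter_upwards [h'] with w hw i j e
  by_contra hne
  exact hw i j hne e

-- A partition of unity according to the position of the largest coordinate.
open Classical in
theorem sum_ite_max {n : ℕ} {w : Fin (n + 1) → ℝ} (hw : Function.Injective w) (z : ℂ) :
    ∑ i : Fin (n + 1), (if ∀ j, i.removeNth w j ≤ w i then z else 0) = z := by
  obtain ⟨i, -, hi⟩ := Finset.exists_max_image Finset.univ w Finset.univ_nonempty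
  rw [Finset.sum_eq_single i]
  · rw [if_pos]
    exact fun j => hi _ (Finset.mem_univ _)
  · intro b _ hb
    rw [if_neg]
    intro h
    obtain ⟨j, hj⟩ := Fin.exists_succAbove_eq hb.symm
    have h1 := h j
    rw [Fin.removeNth, hj] at h1
    exact hb (hw (le_antisymm (hi b (Finset.mem_univ _)) h1))
  · simp

open Classical in
theorem integral_ite_le {n : ℕ} (a t z : ℝ) (hz : z ≤ t) (f : (Fin n → ℝ) → ℂ) :
    ∫ v, (if ∀ j, v j ≤ z then f v else 0)
      ∂(Measure.pi fun _ : Fin n => (volume : Measure ℝ).restrict (Ioc a t)) =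
    ∫ v, f v ∂(Measure.pi fun _ : Fin n => (volume : Measure ℝ).restrict (Ioc a z)) := by
  have hm : MeasurableSet (univ.pi fun _ : Fin n => Iic z) :=
    MeasurableSet.univ_pi fun _ => measurableSet_Iic
  have e : (fun v : Fin n → ℝ => if ∀ j, v j ≤ z then f v else 0) =
      (univ.pi fun _ : Fin n => Iic z).indicator f := by
    ext v; simp [indicator_apply, Pi.le_def]
  rw [e, integral_indicator hm, Measure.restrict_pi_pi, Measure.restrict_restrict measurableSet_Iic]
  have : Iic z ∩ Ioc a t = Ioc a z := by
    ext y; simp only [mem_inter_iff, mem_Iic, mem_Ioc]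
    constructor
    · rintro ⟨h1, h2, h3⟩; exact ⟨h2, h1⟩
    · rintro ⟨h1, h2⟩; exact ⟨h2, h1, h2.trans hz⟩
  rw [this]

/-- The determinant is invariant under simultaneous permutation of rows and columns. Hence the n + 1
regions where a given coordinate is the largest contribute equally, and if that coordinate is u the
others range over (a,u]. -/
theorem detIntegral_succ_eq (k : (ℝ × ℝ) →ᵇ ℂ) (a t : ℝ) (n : ℕ) :
    IntegrableOn (fun u => minorIntegral (volume.restrict (Ioc a u)) k n (u, u)) (Ioc a t) ∧
    detIntegral (volume.restrict (Ioc a t)) k (n + 1) =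
      (n + 1) * ∫ u in Ioc a t, minorIntegral (volume.restrict (Ioc a u)) k n (u, u) := by
  classical
  set μ : Measure ℝ := volume.restrict (Ioc a t)
  let g : ℝ → (Fin n → ℝ) → ℂ := fun z v => if ∀ j, v j ≤ z then
    (kernelMatrix k (Fin.cons z v : Fin (n + 1) → ℝ) (Fin.cons z v)).det else 0
  have hc : Continuous fun q : ℝ × (Fin n → ℝ) =>
      (kernelMatrix k (Fin.cons q.1 q.2 : Fin (n + 1) → ℝ) (Fin.cons q.1 q.2)).det :=
    (continuous_det_kernelMatrix k (n + 1)).comp ((continuous_cons n).prodMk (continuous_cons n))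
  have hS : MeasurableSet {q : ℝ × (Fin n → ℝ) | ∀ j, q.2 j ≤ q.1} := by
    rw [show {q : ℝ × (Fin n → ℝ) | ∀ j, q.2 j ≤ q.1} = ⋂ j, {q | q.2 j ≤ q.1} by ext; simp]
    exact MeasurableSet.iInter fun j => measurableSet_le (by fun_prop) (by fun_prop)
  have hg : Integrable (fun q : ℝ × (Fin n → ℝ) => g q.1 q.2) (μ.prod (Measure.pi fun _ => μ)) :=
    (integrable_of_continuous_bounded hc (C := hadamardBound ‖k‖ (n + 1))
      fun q => norm_det_kernelMatrix_le _ _ _).indicator hS |>.congr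
        (Eventually.of_forall fun q => by simp [g, indicator_apply])
  have hinner : ∀ z ∈ Ioc a t, ∫ v, g z v ∂(Measure.pi fun _ => μ) =
      minorIntegral (volume.restrict (Ioc a z)) k n (z, z) :=
    fun z hz => integral_ite_le a t z hz.2 _
  constructor
  · refine hg.integral_prod_left.congr ?_
    filter_upwards [ae_restrict_mem measurableSet_Ioc] with z hz using hinner z hz
  · have e1 : detIntegral μ k (n + 1) =
        ∫ w : Fin (n + 1) → ℝ, ∑ i, g (w i) (i.removeNth w) ∂(Measure.pi fun _ => μ) := by
      refine integral_congr_ae ?_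
      filter_upwards [ae_injective_pi_restrict (Ioc a t)] with w hw
      rw [← sum_ite_max hw (kernelMatrix k w w).det]
      refine Finset.sum_congr rfl fun i _ => ?_
      simp only [g]
      congr 1
      rw [Fin.cons_removeNth_eq_comp_cycleRange_symm, det_kernelMatrix_comp_perm_both]
    rw [e1, integral_finsetSum _ fun i _ => integrable_pi_removeNth μ i g hg,
      Finset.sum_congr rfl fun i _ => integral_pi_removeNth μ i g hg,
      setIntegral_congr_fun measurableSet_Ioc fun z hz => (hinner z hz).symm]
    simp [μ]

/-- A bound for Fredholm's minor on a set of measure `V`. -/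
noncomputable def minorBound (M C V : ℝ) : ℝ :=
  ∑' n : ℕ, (C * V) ^ n / n.factorial * hadamardBound M (n + 1)

theorem norm_minor_term_apply_le (k : (ℝ × ℝ) →ᵇ ℂ) (c : ℂ) {a t u : ℝ} (hu : u ∈ Ioc a t) (n : ℕ)
    (p : ℝ × ℝ) :
    ‖c ^ n / (n.factorial : ℂ) * minorIntegral (volume.restrict (Ioc a u)) k n p‖ ≤
      (‖c‖ * (t - a)) ^ n / n.factorial * hadamardBound ‖k‖ (n + 1) := by
  have h := ((minorKernel (volume.restrict (Ioc a u)) k n).norm_coe_le_norm p)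
  have h2 := norm_minor_term_le (volume.restrict (Ioc a u)) k c n
  rw [norm_smul] at h2
  rw [norm_mul]
  have h3 : (volume.restrict (Ioc a u)).real univ = u - a := by
    simp [Measure.real, hu.1.le]
  rw [h3] at h2
  have h4 := hadamardBound_nonneg ‖k‖ (n + 1)
  have h5 : 0 ≤ u - a := by linarith [hu.1]
  have h6 : u - a ≤ t - a := by linarith [hu.2]
  calc _ ≤ ‖c ^ n / (n.factorial : ℂ)‖ * ‖minorKernel (volume.restrict (Ioc a u)) k n‖ := by
        gcongr; exact h
    _ ≤ _ := h2
    _ ≤ _ := by gcongr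

theorem norm_fredholmMinor_apply_le (k : (ℝ × ℝ) →ᵇ ℂ) (c : ℂ) {a t u : ℝ} (hu : u ∈ Ioc a t)
    (p : ℝ × ℝ) :
    ‖fredholmMinor (volume.restrict (Ioc a u)) k c p‖ ≤ minorBound ‖k‖ ‖c‖ (t - a) :=
  (hasSum_fredholmMinor_apply _ k c p).norm_le_of_bounded
    (summable_hadamardBound (‖c‖ * (t - a)) ‖k‖).hasSum
    fun n => norm_minor_term_apply_le k c hu n p

theorem detIntegral_zero (μ : Measure ℝ) (k : ℝ × ℝ → ℂ) : detIntegral μ k 0 = 1 := by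
  simp [detIntegral, kernelMatrix, Measure.real]

/-- The Fredholm determinant on `(a, t]` as an integral of the diagonal minors on `(a, u]`. -/
theorem fredholmDet_eq_integral (k : (ℝ × ℝ) →ᵇ ℂ) (c : ℂ) (a t : ℝ) :
    IntegrableOn (fun u => fredholmMinor (volume.restrict (Ioc a u)) k c (u, u)) (Ioc a t) ∧
    fredholmDet (volume.restrict (Ioc a t)) (fun x y => k (x, y)) c =
      1 + c * ∫ u in Ioc a t, fredholmMinor (volume.restrict (Ioc a u)) k c (u, u) := by
  set F : ℕ → ℝ → ℂ := fun n u =>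
    c ^ n / (n.factorial : ℂ) * minorIntegral (volume.restrict (Ioc a u)) k n (u, u)
  have hF : ∀ n, IntegrableOn (F n) (Ioc a t) := fun n =>
    (detIntegral_succ_eq k a t n).1.const_mul _
  have hsum : ∀ u, HasSum (fun n => F n u)
      (fredholmMinor (volume.restrict (Ioc a u)) k c (u, u)) := fun u =>
    hasSum_fredholmMinor_apply _ k c (u, u)
  have hs := summable_hadamardBound (‖c‖ * (t - a)) ‖k‖
  constructor
  · refine Integrable.of_bound (C := minorBound ‖k‖ ‖c‖ (t - a)) ?_ ?_
    · refine aestronglyMeasurable_of_tendsto_ae atTop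
        (f := fun n u => ∑ i ∈ Finset.range n, F i u) (fun n => ?_)
        (Eventually.of_forall fun u => (hsum u).tendsto_sum_nat)
      exact (integrable_finsetSum _ fun i _ => hF i).aestronglyMeasurable
    · filter_upwards [ae_restrict_mem measurableSet_Ioc] with u hu
      exact norm_fredholmMinor_apply_le k c hu _
  · have h1 := hasSum_integral_of_dominated_convergence
      (F := F) (μ := volume.restrict (Ioc a t))
      (f := fun u => fredholmMinor (volume.restrict (Ioc a u)) k c (u, u))
      (fun n _ => (‖c‖ * (t - a)) ^ n / n.factorial * hadamardBound ‖k‖ (n + 1))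
      (fun n => (hF n).aestronglyMeasurable)
      (fun n => by
        filter_upwards [ae_restrict_mem measurableSet_Ioc] with u hu
        exact norm_minor_term_apply_le k c hu n _)
      (Eventually.of_forall fun u => hs) (integrable_const _) (Eventually.of_forall hsum)
    have h2 := (hasSum_nat_add_iff' 1).2 (hasSum_fredholmDet (volume.restrict (Ioc a t)) k c)
    have e : (fun n : ℕ => c ^ (n + 1) / ((n + 1).factorial : ℂ) *
        detIntegral (volume.restrict (Ioc a t)) k (n + 1)) =
        fun n => c * ∫ u in Ioc a t, F n u := by
      ext n
      have h1 : (n.factorial : ℂ) ≠ 0 := by exact_mod_cast n.factorial_ne_zero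
      have h2 : (n : ℂ) + 1 ≠ 0 := by exact_mod_cast n.succ_ne_zero
      simp only [F]
      rw [(detIntegral_succ_eq k a t n).2, integral_const_mul, Nat.factorial_succ]
      push_cast
      field_simp
      ring
    rw [e] at h2
    have := h2.unique (h1.mul_left c)
    rw [← this]
    simp [detIntegral_zero]

/-! ### Hankel operators on (-T,s] and their dependence on s. -/

/-- Differentiation of an integral whose upper limit and integrand depend on the parameter,
at a point where the interval of integration is degenerate. -/
theorem hasDerivWithinAt_integral_diag {E : Type*} [NormedAddCommGroup E] [NormedSpace ℝ E]
    [CompleteSpace E] {V : ℝ → ℝ → E} {S : Set ℝ} {t : ℝ}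
    (hV : ContinuousWithinAt (Function.uncurry V) (S ×ˢ univ) (t, t))
    (hc : ∀ s ∈ S, Continuous (V s)) :
    HasDerivWithinAt (fun s => ∫ y in t..s, V s y) (V t t) S t := by
  rw [hasDerivWithinAt_iff_isLittleO, Asymptotics.isLittleO_iff]
  intro ε hε
  rw [Metric.continuousWithinAt_iff] at hV
  obtain ⟨δ, hδ, h⟩ := hV ε hε
  have hball : ∀ᶠ s in 𝓝[S] t, dist s t < δ :=
    nhdsWithin_le_nhds (Metric.ball_mem_nhds t hδ)
  filter_upwards [hball, self_mem_nhdsWithin] with s hs hsS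
  rw [intervalIntegral.integral_same, sub_zero, ← intervalIntegral.integral_const,
    ← intervalIntegral.integral_sub ((hc s hsS).intervalIntegrable _ _) intervalIntegrable_const]
  refine intervalIntegral.norm_integral_le_of_norm_le_const fun y hy => ?_
  have hy' : dist y t < δ := by
    refine lt_of_le_of_lt ?_ hs
    have := abs_sub_left_of_mem_uIcc (uIoc_subset_uIcc hy)
    simpa [Real.dist_eq, abs_sub_comm] using this
  have h1 := h (x := (s, y)) ⟨hsS, mem_univ _⟩ (by
    rw [Prod.dist_eq]; exact max_lt hs hy')
  rw [dist_eq_norm] at h1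
  exact h1.le

section Hankel

variable (K : ℝ →ᵇ ℂ)

/-- The Hankel kernel `K (x + y)`. -/
noncomputable def hankelKernel : (ℝ × ℝ) →ᵇ ℂ :=
  K.compContinuous ⟨fun p => p.1 + p.2, by fun_prop⟩

@[simp] theorem hankelKernel_apply (x y : ℝ) : hankelKernel K (x, y) = K (x + y) := rfl

theorem hankelKernel_symm (x y : ℝ) : hankelKernel K (x, y) = hankelKernel K (y, x) := by
  simp [add_comm]

/-- The translate `K (x + t)`. -/
noncomputable def kernelShift (t : ℝ) : ℝ →ᵇ ℂ :=
  K.compContinuous ⟨fun x => x + t, by fun_prop⟩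

@[simp] theorem kernelShift_apply (t x : ℝ) : kernelShift K t x = K (x + t) := rfl

/-- Continuity is in the supremum norm, hence the uniform continuity of K. It allows K(· + y) to be
integrated over y as a function with values in the bounded continuous functions. -/
theorem continuous_kernelShift {K : ℝ →ᵇ ℂ} (hK : UniformContinuous K) :
    Continuous (kernelShift K) := by
  rw [Metric.continuous_iff]
  intro b ε hε
  obtain ⟨δ, hδ, h⟩ := Metric.uniformContinuous_iff.1 hK (ε / 2) (half_pos hε)
  refine ⟨δ, hδ, fun a ha => ?_⟩
  refine lt_of_le_of_lt ((BoundedContinuousFunction.dist_le (half_pos hε).le).2 fun x => ?_)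
    (half_lt_self hε)
  exact (h (by simpa using ha)).le

variable (T : ℝ) (c : ℂ)

/-- The Hankel operator on `(-T, s]`. -/
noncomputable def truncHankel (s : ℝ) : (ℝ →ᵇ ℂ) →L[ℂ] (ℝ →ᵇ ℂ) :=
  kernelOp (volume.restrict (Ioc (-T) s)) (hankelKernel K)

/-- The Fredholm determinant of `1 + c K` on `(-T, s]`. -/
noncomputable def truncDet (s : ℝ) : ℂ :=
  fredholmDet (volume.restrict (Ioc (-T) s)) (fun x y => K (x + y)) c

/-- The solution of `f + c K f = g` on `(-T, s]`. -/
noncomputable def hankelSol (s : ℝ) (g : ℝ →ᵇ ℂ) : ℝ →ᵇ ℂ :=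
  Ring.inverse (1 + c • truncHankel K T s) g

theorem truncHankel_apply (s : ℝ) (f : ℝ →ᵇ ℂ) (x : ℝ) :
    truncHankel K T s f x = ∫ y in Ioc (-T) s, K (x + y) * f y := rfl

variable {K T c}

theorem truncHankel_apply_interval {s : ℝ} (hs : -T ≤ s) (f : ℝ →ᵇ ℂ) (x : ℝ) :
    truncHankel K T s f x = ∫ y in (-T)..s, K (x + y) * f y := by
  rw [intervalIntegral.integral_of_le hs, truncHankel_apply]

theorem isUnit_one_add_truncHankel {s : ℝ} (hD : truncDet K T c s ≠ 0) :
    IsUnit (1 + c • truncHankel K T s) :=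
  isUnit_one_add_kernelOp _ (hankelKernel K) (hankelKernel_symm K) c hD

theorem hankelSol_spec {s : ℝ} (hD : truncDet K T c s ≠ 0) (g : ℝ →ᵇ ℂ) :
    hankelSol K T c s g + c • truncHankel K T s (hankelSol K T c s g) = g := by
  have := Ring.mul_inverse_cancel _ (isUnit_one_add_truncHankel hD)
  exact DFunLike.congr_fun this g

theorem hankelSol_spec_apply {s : ℝ} (hD : truncDet K T c s ≠ 0) (g : ℝ →ᵇ ℂ) (x : ℝ) :
    hankelSol K T c s g x + c * ∫ y in Ioc (-T) s, K (x + y) * hankelSol K T c s g y = g x :=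
  DFunLike.congr_fun (hankelSol_spec hD g) x

theorem hankelSol_unique {s : ℝ} (hD : truncDet K T c s ≠ 0) {f g : ℝ →ᵇ ℂ}
    (h : f + c • truncHankel K T s f = g) : f = hankelSol K T c s g := by
  have := Ring.inverse_mul_cancel _ (isUnit_one_add_truncHankel hD)
  rw [← h]
  exact (DFunLike.congr_fun this f).symm

theorem hankelSol_smul (s : ℝ) (g : ℝ →ᵇ ℂ) (a : ℂ) :
    hankelSol K T c s (a • g) = a • hankelSol K T c s g := by
  simp [hankelSol]

/-- An integrable function satisfying the equation almost everywhere on `(-T, s]` gives the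
solution. -/
theorem hankelSol_eq_of_ae {s : ℝ} (hD : truncDet K T c s ≠ 0) {h : ℝ → ℂ} {g : ℝ →ᵇ ℂ}
    (hi : IntegrableOn h (Ioc (-T) s))
    (he : ∀ᵐ x ∂volume.restrict (Ioc (-T) s),
      h x + c * ∫ y in Ioc (-T) s, K (x + y) * h y = g x) (x : ℝ) :
    g x - c * ∫ y in Ioc (-T) s, K (x + y) * h y = hankelSol K T c s g x := by
  set f : ℝ →ᵇ ℂ := g - c • kernelApply (volume.restrict (Ioc (-T) s)) (hankelKernel K) h hi
    with hf
  have hfx : ∀ x, f x = g x - c * ∫ y in Ioc (-T) s, K (x + y) * h y := fun x => rfl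
  have hae : f =ᵐ[volume.restrict (Ioc (-T) s)] h := by
    filter_upwards [he] with x hx
    rw [hfx, ← hx]; ring
  have hint : ∀ x, ∫ y in Ioc (-T) s, K (x + y) * f y = ∫ y in Ioc (-T) s, K (x + y) * h y := by
    intro x
    refine integral_congr_ae ?_
    filter_upwards [hae] with y hy
    rw [hy]
  rw [← hfx, ← hankelSol_unique hD (f := f) (g := g)]
  ext x
  change f x + c * truncHankel K T s f x = g x
  rw [truncHankel_apply, hint, hfx]; ring

variable (hK : UniformContinuous K)

include hK in
theorem truncHankel_sub_apply {s t : ℝ} (hs : -T ≤ s) (ht : -T ≤ t) (f : ℝ →ᵇ ℂ) :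
    truncHankel K T s f - truncHankel K T t f = ∫ y in t..s, f y • kernelShift K y := by
  have hi : ∀ x a b, IntervalIntegrable (fun y => K (x + y) * f y) volume a b := fun x a b =>
    ((K.continuous.comp (by fun_prop)).mul f.continuous).intervalIntegrable _ _
  ext x
  have hc : Continuous fun y => f y • kernelShift K y :=
    f.continuous.smul (continuous_kernelShift hK)
  have h1 := (BoundedContinuousFunction.evalCLM ℂ x : (ℝ →ᵇ ℂ) →L[ℂ] ℂ).intervalIntegral_comp_comm
    (hc.intervalIntegrable (μ := volume) t s)
  change _ = BoundedContinuousFunction.evalCLM ℂ x (∫ y in t..s, f y • kernelShift K y)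
  rw [← h1]
  change truncHankel K T s f x - truncHankel K T t f x = ∫ y in t..s, f y * K (x + y)
  rw [truncHankel_apply_interval hs, truncHankel_apply_interval ht,
    intervalIntegral.integral_interval_sub_left (hi _ _ _) (hi _ _ _)]
  simp only [mul_comm]

theorem norm_truncHankel_sub_le {s t : ℝ} (hs : -T ≤ s) (ht : -T ≤ t) :
    ‖truncHankel K T s - truncHankel K T t‖ ≤ ‖K‖ * |s - t| := by
  refine ContinuousLinearMap.opNorm_le_bound _ (by positivity) fun f => ?_
  have hi : ∀ x a b, IntervalIntegrable (fun y => K (x + y) * f y) volume a b := fun x a b =>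
    ((K.continuous.comp (by fun_prop)).mul f.continuous).intervalIntegrable _ _
  refine (BoundedContinuousFunction.norm_le (by positivity)).2 fun x => ?_
  change ‖truncHankel K T s f x - truncHankel K T t f x‖ ≤ _
  rw [truncHankel_apply_interval hs, truncHankel_apply_interval ht,
    intervalIntegral.integral_interval_sub_left (hi _ _ _) (hi _ _ _)]
  refine (intervalIntegral.norm_integral_le_of_norm_le_const (C := ‖K‖ * ‖f‖)
    fun y _ => ?_).trans_eq (by ring)
  rw [norm_mul]
  gcongr
  · exact K.norm_coe_le_norm _
  · exact f.norm_coe_le_norm _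

theorem continuousOn_truncHankel : ContinuousOn (truncHankel K T) (Ici (-T)) := by
  intro t ht
  rw [ContinuousWithinAt, tendsto_iff_norm_sub_tendsto_zero]
  refine squeeze_zero' (Eventually.of_forall fun _ => norm_nonneg _) (g := fun s => ‖K‖ * |s - t|)
    ?_ ?_
  · filter_upwards [self_mem_nhdsWithin] with s hs using norm_truncHankel_sub_le hs ht
  · have : Continuous fun s : ℝ => ‖K‖ * |s - t| := by fun_prop
    simpa using (this.tendsto t).mono_left nhdsWithin_le_nhds

theorem continuousOn_inverse_hankel {S : Set ℝ} (hS : S ⊆ Ici (-T))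
    (hD : ∀ s ∈ S, truncDet K T c s ≠ 0) :
    ContinuousOn (fun s => Ring.inverse (1 + c • truncHankel K T s)) S := by
  intro t ht
  obtain ⟨u, hu⟩ := isUnit_one_add_truncHankel (hD t ht)
  have h1 := NormedRing.inverse_continuousAt (R := (ℝ →ᵇ ℂ) →L[ℂ] (ℝ →ᵇ ℂ)) u
  rw [hu] at h1
  exact h1.comp_continuousWithinAt
    (f := fun s => 1 + c • truncHankel K T s)
    (continuousWithinAt_const.add (((continuousOn_truncHankel t (hS ht)).mono hS).const_smul c))

theorem continuousOn_hankelSol {S : Set ℝ} (hS : S ⊆ Ici (-T))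
    (hD : ∀ s ∈ S, truncDet K T c s ≠ 0) {g : ℝ → ℝ →ᵇ ℂ} (hg : ContinuousOn g S) :
    ContinuousOn (fun s => hankelSol K T c s (g s)) S :=
  (continuousOn_inverse_hankel hS hD).clm_apply hg

-- Let f_s be the solution at s. Subtracting the equations at s and t gives (1 + cK_t)(f_s - f_t) =
-- -c∫_t^s f_s(y) K(· + y) dy; then (1 + cK_t)⁻¹ is applied and the integral differentiated at its
-- degenerate endpoint. Only continuity of s ↦ f_s is needed beforehand.
include hK in
theorem hasDerivWithinAt_hankelSol {S : Set ℝ} (hS : S ⊆ Ici (-T))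
    (hD : ∀ s ∈ S, truncDet K T c s ≠ 0) (g : ℝ →ᵇ ℂ) {t : ℝ} (ht : t ∈ S) :
    HasDerivWithinAt (fun s => hankelSol K T c s g)
      (-(c * hankelSol K T c t g t) • hankelSol K T c t (kernelShift K t)) S t := by
  have hcont := continuousOn_hankelSol hS hD (g := fun _ => g) continuousOn_const t ht
  have hW : HasDerivWithinAt
      (fun s => ∫ y in t..s, hankelSol K T c s g y • kernelShift K y)
      (hankelSol K T c t g t • kernelShift K t) S t := by
    refine hasDerivWithinAt_integral_diag
      (V := fun s y => hankelSol K T c s g y • kernelShift K y) ?_ fun s _ =>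
        (hankelSol K T c s g).continuous.smul (continuous_kernelShift hK)
    have h1 : ContinuousWithinAt (fun q : ℝ × ℝ => (hankelSol K T c q.1 g, q.2))
        (S ×ˢ univ) (t, t) :=
      (ContinuousWithinAt.comp (f := fun q : ℝ × ℝ => q.1) (x := (t, t)) hcont
        continuousWithinAt_fst fun q hq => hq.1).prodMk continuousWithinAt_snd
    have h2 := (continuous_eval (F := ℝ →ᵇ ℂ) (X := ℝ) (Y := ℂ)).continuousAt.comp_continuousWithinAt h1
    exact h2.smul ((continuous_kernelShift hK).comp continuous_snd).continuousWithinAt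
  set B := Ring.inverse (1 + c • truncHankel K T t)
  have h3 := ((B.restrictScalars ℝ).hasFDerivAt.comp_hasDerivWithinAt t hW).const_smul (-c)
    |>.const_add (hankelSol K T c t g)
  refine (h3.congr_deriv ?_).congr_of_mem (fun s hs => ?_) ht
  · simp only [ContinuousLinearMap.coe_restrictScalars', map_smul, smul_smul, neg_mul]
    rfl
  · change _ = hankelSol K T c t g +
      -c • B (∫ y in t..s, hankelSol K T c s g y • kernelShift K y)
    rw [← truncHankel_sub_apply hK (hS hs) (hS ht)]
    have e1 := hankelSol_spec (hD s hs) g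
    have e2 := hankelSol_spec (hD t ht) g
    set fs := hankelSol K T c s g
    set ft := hankelSol K T c t g
    have e3 : (1 + c • truncHankel K T t) (fs - ft) =
        -c • (truncHankel K T s fs - truncHankel K T t fs) := by
      change (fs - ft) + c • truncHankel K T t (fs - ft) = _
      rw [map_sub, smul_sub, neg_smul, smul_sub]
      linear_combination (exp := 1) e1 - e2
    have e4 := congrArg B e3
    have e5 : B ((1 + c • truncHankel K T t) (fs - ft)) = fs - ft :=
      DFunLike.congr_fun (Ring.inverse_mul_cancel _ (isUnit_one_add_truncHankel (hD t ht))) _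
    rw [e5, map_smul] at e4
    rw [← e4]; abel

end Hankel

/-! ### The constant right side, and logarithmic derivatives of the determinants. -/

section Hankel

variable {K : ℝ →ᵇ ℂ} {T : ℝ} {c : ℂ}

theorem integral_kernel_add (hK0 : ∀ x ≤ 0, K x = 0) {x v : ℝ} (hx : x ≤ T) :
    ∫ y in (-T)..v, K (x + y) = ∫ u in (0 : ℝ)..(x + v), K u := by
  have hi : ∀ a b, IntervalIntegrable K volume a b := fun a b => K.continuous.intervalIntegrable a b
  rw [intervalIntegral.integral_comp_add_left (fun u => K u) x,
    ← intervalIntegral.integral_add_adjacent_intervals (hi _ 0) (hi 0 _), add_eq_right]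
  rw [intervalIntegral.integral_congr (g := fun _ => (0 : ℂ))]
  · simp
  · intro u hu
    rw [uIcc_of_le (by linarith)] at hu
    exact hK0 u hu.2

/-- Let J be the primitive of K vanishing at 0 and φ the solution for -c. Integration by parts moves
the derivative from J(x+y) to 1 + c∫_y^t φ, the boundary term at -T vanishing because x - T ≤ 0.
Writing J(x+v) as the integral of K(w+v) over w in (-T,x) and exchanging integrals, the equation of
φ evaluates the remaining term as ∫_{-T}^x φ - J(x+t), and the x-dependence cancels. -/
theorem hankelSol_diag_aux (hK0 : ∀ x ≤ 0, K x = 0) {t : ℝ} (hT : 0 ≤ T) (ht0 : 0 ≤ t) (htT : t ≤ T)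
    (hD' : truncDet K T (-c) t ≠ 0) {x : ℝ} (hx : x ∈ Icc (-T) t) :
    (1 + c * ∫ y in x..t, hankelSol K T (-c) t (kernelShift K t) y) +
      c * (∫ y in (-T)..t, K (x + y) *
        (1 + c * ∫ v in y..t, hankelSol K T (-c) t (kernelShift K t) v)) =
    1 + c * ∫ y in (-T)..t, hankelSol K T (-c) t (kernelShift K t) y := by
  set φ := hankelSol K T (-c) t (kernelShift K t) with hφ
  have hspec : ∀ w, φ w - c * ∫ v in (-T)..t, K (w + v) * φ v = K (w + t) := by
    intro w
    have := hankelSol_spec_apply hD' (kernelShift K t) w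
    rw [← intervalIntegral.integral_of_le (by linarith)] at this
    rw [← kernelShift_apply, ← this]; ring
  have hφi : ∀ a b, IntervalIntegrable φ volume a b := fun a b => φ.continuous.intervalIntegrable a b
  set J : ℝ → ℂ := fun r => ∫ u in (0 : ℝ)..r, K u with hJ
  have hJd : ∀ r, HasDerivAt J (K r) r := fun r =>
    intervalIntegral.integral_hasDerivAt_right (K.continuous.intervalIntegrable _ _)
      (K.continuous.stronglyMeasurableAtFilter _ _) K.continuous.continuousAt
  have hJneg : J (x - T) = 0 := by
    have := integral_kernel_add hK0 (x := x) (v := -T) (hx.2.trans htT)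
    rw [intervalIntegral.integral_same] at this
    rw [hJ]; simp only [sub_eq_add_neg]; exact this.symm
  have hGd : ∀ y, HasDerivAt (fun y => 1 + c * ∫ v in y..t, φ v) (c * -φ y) y := fun y =>
    ((intervalIntegral.integral_hasDerivAt_left (hφi _ _)
      (φ.continuous.stronglyMeasurableAtFilter _ _) φ.continuous.continuousAt).const_mul c).const_add 1
  have hibp := intervalIntegral.integral_mul_deriv_eq_deriv_mul (a := -T) (b := t)
    (u := fun y => 1 + c * ∫ v in y..t, φ v) (v := fun y => J (x + y))
    (u' := fun y => c * -φ y) (v' := fun y => K (x + y))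
    (fun y _ => hGd y) (fun y _ => (hJd (x + y)).comp_const_add x y)
    ((continuous_const.mul φ.continuous.neg).intervalIntegrable _ _)
    ((K.continuous.comp (by fun_prop)).intervalIntegrable _ _)
  have h1 : ∫ y in (-T)..t, K (x + y) * (1 + c * ∫ v in y..t, φ v) =
      J (x + t) + c * ∫ v in (-T)..t, J (x + v) * φ v := by
    rw [intervalIntegral.integral_congr (g := fun y => (1 + c * ∫ v in y..t, φ v) * K (x + y))
      fun y _ => mul_comm _ _, hibp, intervalIntegral.integral_same, ← sub_eq_add_neg, hJneg]
    have e : ∫ y in (-T)..t, c * -φ y * J (x + y) = ∫ y in (-T)..t, (-c) * (J (x + y) * φ y) := by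
      congr 1 with y; ring
    rw [e, intervalIntegral.integral_const_mul]
    ring
  have h2 : ∫ v in (-T)..t, J (x + v) * φ v =
      ∫ w in (-T)..x, ∫ v in (-T)..t, K (w + v) * φ v := by
    have e : ∀ v ∈ uIcc (-T) t, J (x + v) * φ v = ∫ w in (-T)..x, K (w + v) * φ v := by
      intro v hv
      rw [uIcc_of_le (by linarith)] at hv
      rw [intervalIntegral.integral_mul_const]
      congr 1
      have := integral_kernel_add hK0 (x := v) (v := x) (hv.2.trans htT)
      simp only [add_comm v] at this
      exact this.symm
    rw [intervalIntegral.integral_congr e]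
    have hc : Continuous fun q : ℝ × ℝ => K (q.2 + q.1) * φ q.1 :=
      (K.continuous.comp (by fun_prop)).mul (φ.continuous.comp (by fun_prop))
    refine intervalIntegral_intervalIntegral_swap ?_
    exact hc.continuousOn.integrableOn_compact (isCompact_uIcc.prod isCompact_uIcc) |>.mono_set
      (prod_mono uIoc_subset_uIcc uIoc_subset_uIcc)
  have h3 : c * ∫ w in (-T)..x, ∫ v in (-T)..t, K (w + v) * φ v =
      (∫ w in (-T)..x, φ w) - J (x + t) := by
    have e : ∀ w, c * ∫ v in (-T)..t, K (w + v) * φ v = φ w - K (w + t) := by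
      intro w; rw [← hspec w]; ring
    rw [← intervalIntegral.integral_const_mul]
    simp only [e]
    have hi2 : IntervalIntegrable (fun w => K (w + t)) volume (-T) x :=
      (K.continuous.comp (by fun_prop : Continuous fun w : ℝ => w + t)).intervalIntegrable _ _
    rw [intervalIntegral.integral_sub (hφi _ _) hi2]
    congr 1
    have := integral_kernel_add hK0 (x := t) (v := x) htT
    simp only [add_comm t] at this
    exact this
  rw [h1, h2, mul_add, ← mul_assoc, mul_assoc c c, h3,
    ← intervalIntegral.integral_add_adjacent_intervals (hφi (-T) x) (hφi x t)]
  ring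

/-- The solution with constant right-hand side is, on `[-T, t]`, a constant multiple of a primitive
of the solution with right-hand side `K (· + t)` and the opposite sign. -/
theorem hankelSol_one_eq (hK0 : ∀ x ≤ 0, K x = 0) {t : ℝ} (hT : 0 ≤ T) (ht0 : 0 ≤ t) (htT : t ≤ T)
    (hD : truncDet K T c t ≠ 0) (hD' : truncDet K T (-c) t ≠ 0) :
    hankelSol K T c t 1 t ≠ 0 ∧ ∀ x ∈ Icc (-T) t, hankelSol K T c t 1 x =
      hankelSol K T c t 1 t * (1 + c * ∫ y in x..t, hankelSol K T (-c) t (kernelShift K t) y) := by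
  set φ := hankelSol K T (-c) t (kernelShift K t)
  set e : ℂ := 1 + c * ∫ y in (-T)..t, φ y
  have hGc : Continuous fun y => 1 + c * ∫ v in y..t, φ v := by
    have : ∀ y, HasDerivAt (fun y => 1 + c * ∫ v in y..t, φ v) (c * -φ y) y := fun y =>
      ((intervalIntegral.integral_hasDerivAt_left (φ.continuous.intervalIntegrable _ _)
        (φ.continuous.stronglyMeasurableAtFilter _ _) φ.continuous.continuousAt).const_mul c).const_add 1
    exact continuous_iff_continuousAt.2 fun y => (this y).continuousAt
  have heq : ∀ x ∈ Icc (-T) t, (1 + c * ∫ y in x..t, φ y) +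
      c * ∫ y in Ioc (-T) t, K (x + y) * (1 + c * ∫ v in y..t, φ v) = e := by
    intro x hx
    rw [← intervalIntegral.integral_of_le (by linarith)]
    exact hankelSol_diag_aux hK0 hT ht0 htT hD' hx
  have hG : ∀ x ∈ Icc (-T) t, 1 + c * ∫ y in x..t, φ y = e * hankelSol K T c t 1 x := by
    intro x hx
    have h1 := hankelSol_eq_of_ae hD (h := fun y => 1 + c * ∫ v in y..t, φ v) (g := e • 1)
      ((hGc.integrableOn_Icc).mono_set Ioc_subset_Icc_self) (by
        filter_upwards [ae_restrict_mem measurableSet_Ioc] with y hy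
        rw [heq y (Ioc_subset_Icc_self hy)]; simp) x
    rw [hankelSol_smul] at h1
    simp only [BoundedContinuousFunction.coe_smul, BoundedContinuousFunction.coe_one,
      Pi.one_apply, smul_eq_mul, mul_one] at h1
    rw [← h1, ← heq x hx]; ring
  -- At x = t the left side of `hG` is 1, so e times the boundary value is 1: this gives both the
  -- non-vanishing and the normalization.
  have ht : t ∈ Icc (-T) t := ⟨by linarith, le_rfl⟩
  have h1 := hG t ht
  rw [intervalIntegral.integral_same, mul_zero, add_zero] at h1
  refine ⟨right_ne_zero_of_mul (h1 ▸ one_ne_zero), fun x hx => ?_⟩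
  rw [hG x hx, ← mul_assoc, mul_comm _ e, ← h1, one_mul]

/-- On the diagonal Fredholm's minor is the determinant times a resolvent value. -/
theorem fredholmMinor_eq_truncDet_mul {s : ℝ} (hD : truncDet K T c s ≠ 0) (u x : ℝ) :
    fredholmMinor (volume.restrict (Ioc (-T) s)) (hankelKernel K) c (x, u) =
      truncDet K T c s * hankelSol K T c s (kernelShift K u) x := by
  set R := fredholmMinor (volume.restrict (Ioc (-T) s)) (hankelKernel K) c
  let r : ℝ →ᵇ ℂ := R.compContinuous ⟨fun x => (x, u), by fun_prop⟩
  have h1 : r + c • truncHankel K T s r = truncDet K T c s • kernelShift K u := by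
    ext x
    exact DFunLike.congr_fun (fredholmMinor_add_comp (volume.restrict (Ioc (-T) s))
      (hankelKernel K) c) (x, u)
  have h2 := hankelSol_unique hD h1
  rw [hankelSol_smul] at h2
  exact DFunLike.congr_fun h2 x

variable (hK : UniformContinuous K)

include hK in
theorem continuousOn_resolvent {S : Set ℝ} (hS : S ⊆ Ici (-T))
    (hD : ∀ s ∈ S, truncDet K T c s ≠ 0) :
    ContinuousOn (fun s => hankelSol K T c s (kernelShift K s)) S :=
  continuousOn_hankelSol hS hD (continuous_kernelShift hK).continuousOn

theorem continuousOn_eval {S : Set ℝ} {f : ℝ → ℝ →ᵇ ℂ} (hf : ContinuousOn f S) :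
    ContinuousOn (fun s => f s s) S :=
  (continuous_eval (F := ℝ →ᵇ ℂ) (X := ℝ) (Y := ℂ)).comp_continuousOn (hf.prodMk continuousOn_id)

theorem truncDet_eq_integral {s : ℝ} (hs : -T ≤ s) :
    truncDet K T c s = 1 + c * ∫ u in (-T)..s,
      fredholmMinor (volume.restrict (Ioc (-T) u)) (hankelKernel K) c (u, u) := by
  rw [intervalIntegral.integral_of_le hs]
  exact (fredholmDet_eq_integral (hankelKernel K) c (-T) s).2

theorem continuousOn_truncDet (hT : 0 ≤ T) : ContinuousOn (truncDet K T c) (Icc (-T) T) := by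
  have h := intervalIntegral.continuousOn_primitive_interval (a := -T) (b := T)
    (μ := volume) (f := fun u => fredholmMinor (volume.restrict (Ioc (-T) u)) (hankelKernel K) c (u, u))
    (by
      rw [uIcc_of_le (by linarith), integrableOn_Icc_iff_integrableOn_Ioc]
      exact (fredholmDet_eq_integral (hankelKernel K) c (-T) T).1)
  rw [uIcc_of_le (by linarith)] at h
  refine (continuousOn_const.add (continuousOn_const.mul h)).congr fun s hs =>
    truncDet_eq_integral hs.1

-- On [0,T) the diagonal minor is the determinant times a resolvent value, hence continuous, and the
-- fundamental theorem of calculus applies to `truncDet_eq_integral`. Non-vanishing is assumed only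
-- from 0 onwards, so a right derivative is taken.
include hK in
theorem hasDerivWithinAt_truncDet (hD : ∀ s ∈ Ico 0 T, truncDet K T c s ≠ 0) {t : ℝ}
    (ht : t ∈ Ico 0 T) :
    HasDerivWithinAt (truncDet K T c)
      (c * (truncDet K T c t * hankelSol K T c t (kernelShift K t) t)) (Ici t) t := by
  have hT : 0 ≤ T := ht.1.trans ht.2.le
  set F : ℝ → ℂ :=
    fun u => fredholmMinor (volume.restrict (Ioc (-T) u)) (hankelKernel K) c (u, u)
  have hS : Ico 0 T ⊆ Ici (-T) := fun s hs => by
    have := hs.1; rw [mem_Ici]; linarith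
  have hF : ContinuousOn F (Ico 0 T) := by
    refine ContinuousOn.congr (f := fun s => truncDet K T c s *
      hankelSol K T c s (kernelShift K s) s) ?_
      fun s hs => fredholmMinor_eq_truncDet_mul (hD s hs) s s
    exact ((continuousOn_truncDet hT).mono fun s hs => ⟨hS hs, hs.2.le⟩).mul
      (continuousOn_eval (continuousOn_resolvent hK hS hD))
  have hint := (fredholmDet_eq_integral (hankelKernel K) c (-T) T).1
  have hIco : Ico t T ∈ 𝓝[≥] t := Ico_mem_nhdsGE ht.2
  have h1 : HasDerivWithinAt (fun s => ∫ u in (-T)..s, F u) (F t) (Ici t) t := by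
    refine intervalIntegral.integral_hasDerivWithinAt_right ?_ (t := Ioi t) ?_ ?_
    · rw [intervalIntegrable_iff_integrableOn_Ioc_of_le (by linarith [ht.1])]
      exact hint.mono_set (Ioc_subset_Ioc_right ht.2.le)
    · refine ⟨Ioc (-T) T, ?_, hint.aestronglyMeasurable⟩
      exact mem_of_superset (Ioc_mem_nhdsGT ht.2) (Ioc_subset_Ioc_left (by linarith [ht.1]))
    · have h2 := (hF t ht).mono (Ico_subset_Ico_left ht.1 : Ico t T ⊆ Ico 0 T)
      exact (h2.mono_of_mem_nhdsWithin hIco).mono Ioi_subset_Ici_self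
  have h2 := (h1.const_mul c).const_add 1
  rw [show F t = _ from fredholmMinor_eq_truncDet_mul (hD t ht) t t] at h2
  refine h2.congr_of_mem (fun s hs => truncDet_eq_integral ?_) self_mem_Ici
  rw [mem_Ici] at hs; linarith [ht.1]

-- Here s is both the parameter and the point of evaluation. Evaluating `hankelSol_one_eq` at the
-- fixed point t expresses the boundary value at s as the solution at t divided by 1 + c∫_t^s φ,
-- with φ the resolvent for -c. Numerator and denominator each contribute one of the two terms.
include hK in
theorem hasDerivWithinAt_hankelSol_diag (hK0 : ∀ x ≤ 0, K x = 0)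
    (hD : ∀ s ∈ Ico 0 T, truncDet K T c s ≠ 0) (hD' : ∀ s ∈ Ico 0 T, truncDet K T (-c) s ≠ 0)
    {t : ℝ} (ht : t ∈ Ico 0 T) :
    HasDerivWithinAt (fun s => hankelSol K T c s 1 s)
      (-(c * hankelSol K T c t 1 t) * (hankelSol K T c t (kernelShift K t) t +
        hankelSol K T (-c) t (kernelShift K t) t)) (Ici t) t := by
  have hT : 0 ≤ T := ht.1.trans ht.2.le
  have hS : Ico 0 T ⊆ Ici (-T) := fun s hs => by
    have := hs.1; rw [mem_Ici]; linarith
  have hN : HasDerivWithinAt (fun s => hankelSol K T c s 1 t)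
      (-(c * hankelSol K T c t 1 t) * hankelSol K T c t (kernelShift K t) t) (Ico 0 T) t :=
    ((BoundedContinuousFunction.evalCLM ℂ t : (ℝ →ᵇ ℂ) →L[ℂ] ℂ).restrictScalars ℝ).hasFDerivAt.comp_hasDerivWithinAt
      t (hasDerivWithinAt_hankelSol hK hS hD 1 ht)
  have hφ := continuousOn_resolvent hK hS hD'
  have hQ : HasDerivWithinAt
      (fun s => 1 + c * ∫ y in t..s, hankelSol K T (-c) s (kernelShift K s) y)
      (c * hankelSol K T (-c) t (kernelShift K t) t) (Ico 0 T) t := by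
    refine ((hasDerivWithinAt_integral_diag
      (V := fun s y => hankelSol K T (-c) s (kernelShift K s) y) ?_ fun s _ =>
        BoundedContinuousFunction.continuous _).const_mul c).const_add 1
    have h1 : ContinuousWithinAt (fun q : ℝ × ℝ => (hankelSol K T (-c) q.1 (kernelShift K q.1), q.2))
        (Ico 0 T ×ˢ univ) (t, t) :=
      (ContinuousWithinAt.comp (f := fun q : ℝ × ℝ => q.1) (x := (t, t)) (hφ t ht)
        continuousWithinAt_fst fun q hq => hq.1).prodMk continuousWithinAt_snd
    exact (continuous_eval (F := ℝ →ᵇ ℂ) (X := ℝ) (Y := ℂ)).continuousAt.comp_continuousWithinAt h1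
  have hq : (1 + c * ∫ y in t..t, hankelSol K T (-c) t (kernelShift K t) y) ≠ 0 := by simp
  have hsub : Ico t T ⊆ Ico 0 T := Ico_subset_Ico_left ht.1
  have hdiv := (hN.div hQ hq).mono hsub
  have hmem : t ∈ Ico t T := ⟨le_rfl, ht.2⟩
  have h3 := hdiv.congr_of_eventuallyEq_of_mem (f₁ := fun s => hankelSol K T c s 1 s) (by
    have hne : ∀ᶠ s in 𝓝[Ico t T] t,
        (1 + c * ∫ y in t..s, hankelSol K T (-c) s (kernelShift K s) y) ≠ 0 :=
      ((hQ.mono hsub).continuousWithinAt.eventually_ne hq)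
    filter_upwards [hne, self_mem_nhdsWithin] with s hs hsI
    have h4 := (hankelSol_one_eq hK0 hT (ht.1.trans hsI.1) hsI.2.le (hD s (hsub hsI))
      (hD' s (hsub hsI))).2 t ⟨by linarith [ht.1], hsI.1⟩
    simp only [Pi.div_apply]
    rw [h4, mul_div_cancel_right₀ _ hs]) hmem
  refine (h3.mono_of_mem_nhdsWithin (Ico_mem_nhdsGE ht.2)).congr_deriv ?_
  rw [intervalIntegral.integral_same]
  ring

theorem hankelSol_apply_eq {s : ℝ} (hK0 : ∀ x ≤ 0, K x = 0) (hD : truncDet K T c s ≠ 0) (g : ℝ →ᵇ ℂ) {x : ℝ}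
    (hx : x ≤ -s) : hankelSol K T c s g x = g x := by
  rw [← hankelSol_spec_apply hD g x, setIntegral_eq_zero_of_forall_eq_zero]
  · simp
  · intro y hy
    rw [hK0 _ (by linarith [hy.2]), zero_mul]

theorem fredholmMinor_hankel_eq_zero (hK0 : ∀ x ≤ 0, K x = 0) {u : ℝ} (hu : u ≤ 0) :
    fredholmMinor (volume.restrict (Ioc (-T) u)) (hankelKernel K) c (u, u) = 0 := by
  have h := DFunLike.congr_fun (fredholmMinor_add_comp (volume.restrict (Ioc (-T) u))
      (hankelKernel K) c) (u, u)
  simp only [BoundedContinuousFunction.coe_add, BoundedContinuousFunction.coe_smul,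
      Pi.add_apply, kernelComp_apply, smul_eq_mul, hankelKernel_apply] at h
  rw [setIntegral_eq_zero_of_forall_eq_zero, hK0 _ (by linarith)] at h
  · simpa using h
  · intro y hy
    rw [hK0 _ (by linarith [hy.2]), zero_mul]

theorem truncDet_zero (hT : 0 ≤ T) (hK0 : ∀ x ≤ 0, K x = 0) : truncDet K T c 0 = 1 := by
  rw [truncDet_eq_integral (by linarith), intervalIntegral.integral_of_le (by linarith),
    setIntegral_eq_zero_of_forall_eq_zero fun u hu => fredholmMinor_hankel_eq_zero hK0 hu.2]
  simp

include hK in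
/-- The relation between the boundary value of the solution and the Fredholm determinants. -/
theorem truncDet_mul_hankelSol (hK0 : ∀ x ≤ 0, K x = 0)
    (hD : ∀ s ∈ Ico 0 T, truncDet K T c s ≠ 0) (hD' : ∀ s ∈ Ico 0 T, truncDet K T (-c) s ≠ 0)
    {t : ℝ} (ht : t ∈ Ico 0 T) :
    truncDet K T c t * hankelSol K T c t 1 t = truncDet K T (-c) t := by
  have hT : 0 ≤ T := ht.1.trans ht.2.le
  have hsub : Icc 0 t ⊆ Ico 0 T := Icc_subset_Ico_right ht.2
  have hS : Icc 0 t ⊆ Ici (-T) := fun s hs => by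
    have := hs.1; rw [mem_Ici]; linarith
  have hS' : Icc 0 t ⊆ Icc (-T) T := fun s hs => ⟨hS hs, hs.2.trans ht.2.le⟩
  -- With φ_{±c} the resolvent values on the diagonal, the logarithmic derivatives of the three
  -- factors are cφ_c, -c(φ_c + φ_{-c}) and, from the denominator, +cφ_{-c}; they add up to 0.
  have key := constant_of_has_deriv_right_zero (a := 0) (b := t)
    (f := fun s => truncDet K T c s * hankelSol K T c s 1 s / truncDet K T (-c) s)
    (((continuousOn_truncDet hT).mono hS').mul
      (continuousOn_eval (continuousOn_hankelSol hS (fun s hs => hD s (hsub hs))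
        continuousOn_const)) |>.div ((continuousOn_truncDet hT).mono hS')
        fun s hs => hD' s (hsub hs))
    (fun s hs => by
      have hs' := hsub (Ico_subset_Icc_self hs)
      have h1 := hasDerivWithinAt_truncDet hK hD hs'
      have h2 := hasDerivWithinAt_truncDet hK hD' hs'
      have h3 := hasDerivWithinAt_hankelSol_diag hK hK0 hD hD' hs'
      refine ((h1.mul h3).div h2 (hD' s hs')).congr_deriv ?_
      rw [div_eq_zero_iff]
      left
      simp only [Pi.mul_apply]
      ring) t ⟨ht.1, le_rfl⟩
  have h0 : hankelSol K T c 0 1 0 = 1 := by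
    rw [hankelSol_apply_eq hK0 (hD 0 ⟨le_rfl, ht.1.trans_lt ht.2⟩) 1 (by simp)]
    rfl
  simp only [truncDet_zero hT hK0, h0, mul_one, div_one] at key
  exact (div_eq_one_iff_eq (hD' t ht)).1 key

end Hankel

/-! ### Reduction from the half-line (-∞,s] to (-T,s]. -/

section Truncation

variable {K : ℝ → ℂ} (hc : Continuous K) {T : ℝ} (hT : 0 ≤ T)

/-- The kernel `K` restricted to `[0, 2T]` and extended by constants. -/
noncomputable def truncKernel : ℝ →ᵇ ℂ :=
  (BoundedContinuousFunction.mkOfCompact (α := Icc (0 : ℝ) (2 * T))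
    ⟨fun x => K x, hc.comp continuous_subtype_val⟩).compContinuous
      ⟨projIcc 0 (2 * T) (by linarith), continuous_projIcc⟩

theorem uniformContinuous_truncKernel : UniformContinuous (truncKernel hc hT) :=
  (CompactSpace.uniformContinuous_of_continuous (hc.comp continuous_subtype_val)).comp
    (LipschitzWith.projIcc (a := (0 : ℝ)) (b := 2 * T) (by linarith)).uniformContinuous

theorem truncKernel_of_nonpos (hK0 : ∀ x ≤ 0, K x = 0) {x : ℝ} (hx : x ≤ 0) :
    truncKernel hc hT x = 0 := by
  change K (projIcc 0 (2 * T) (by linarith) x) = 0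
  rw [projIcc_of_le_left _ hx]
  exact hK0 _ le_rfl

theorem truncKernel_eq (hK0 : ∀ x ≤ 0, K x = 0) {x : ℝ} (hx : x ≤ 2 * T) :
    truncKernel hc hT x = K x := by
  rcases le_total x 0 with h | h
  · rw [truncKernel_of_nonpos hc hT hK0 h, hK0 x h]
  · change K (projIcc 0 (2 * T) (by linarith) x) = K x
    rw [projIcc_of_mem _ ⟨h, hx⟩]

/-- If some x i ≤ -T, then x i + x j ≤ s - T ≤ 0 for all j, so a row of the matrix vanishes. On the
remaining region x i + x j ≤ 2T, where the two kernels agree. -/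
theorem hankelDet_eq_truncDet (hK0 : ∀ x ≤ 0, K x = 0) (c : ℂ) {s : ℝ} (hsT : s ≤ T) :
    hankelDet K s c = truncDet (truncKernel hc hT) T c s := by
  rw [hankelDet, truncDet, fredholmDet, fredholmDet]
  congr 1 with n
  congr 1
  rw [pi_restrict_eq, pi_restrict_eq, setIntegral_eq_of_subset_of_forall_sdiff_eq_zero
    (MeasurableSet.univ_pi fun _ => measurableSet_Iic)
    (pi_mono fun _ _ => (Ioc_subset_Iic_self : Ioc (-T) s ⊆ Iic s))]
  · refine setIntegral_congr_fun (MeasurableSet.univ_pi fun _ => measurableSet_Ioc) fun x hx => ?_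
    congr 2
    ext i j
    exact (truncKernel_eq hc hT hK0 (by linarith [(hx i trivial).2, (hx j trivial).2])).symm
  · intro x hx
    have : ∃ i, x i ≤ -T := by
      by_contra! h
      exact hx.2 fun i _ => ⟨h i, hx.1 i trivial⟩
    obtain ⟨i, hi⟩ := this
    refine Matrix.det_eq_zero_of_row_eq_zero i fun j => hK0 _ ?_
    have : x j ≤ s := hx.1 j trivial
    linarith

/-- For x ≤ s the kernel annihilates y < -s, so only the values on [-s,s] matter and h is free
elsewhere. -/
theorem hankel_integral_eq (hK0 : ∀ x ≤ 0, K x = 0) {s x : ℝ} (hsT : s ≤ T) (hx : x ≤ s)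
    {f h : ℝ → ℂ} (hfh : ∀ y ∈ Icc (-s) s, f y = h y) :
    hankelOp K s f x = ∫ y in Ioc (-T) s, truncKernel hc hT (x + y) * h y := by
  rw [hankelOp, indicator_of_mem (mem_Iic.2 hx), setIntegral_eq_of_subset_of_forall_sdiff_eq_zero
    measurableSet_Iic (Ioc_subset_Iic_self : Ioc (-T) s ⊆ Iic s)]
  · refine setIntegral_congr_fun measurableSet_Ioc fun y hy => ?_
    rw [truncKernel_eq hc hT hK0 (by linarith [hy.2])]
    rcases lt_or_ge y (-s) with h1 | h1
    · rw [hK0 _ (by linarith), zero_mul, zero_mul]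
    · rw [hfh y ⟨h1, hy.2⟩]
  · intro y hy
    have h1 : y ≤ -T := by
      by_contra! h
      exact hy.2 ⟨h, hy.1⟩
    rw [hK0 _ (by linarith), zero_mul]

theorem hankelOp_eq_zero (hK0 : ∀ x ≤ 0, K x = 0) {s x : ℝ} (hx : x ≤ -s) (f : ℝ → ℂ) :
    hankelOp K s f x = 0 := by
  rw [hankelOp, indicator_apply]
  split_ifs
  · exact setIntegral_eq_zero_of_forall_eq_zero fun y hy => by
      rw [hK0 _ (by linarith [mem_Iic.1 hy]), zero_mul]
  · rfl

variable {c : ℂ} {s : ℝ} (hs : 0 ≤ s) (hsT : s < T) {g : ℝ → ℂ} {g' : ℝ →ᵇ ℂ}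
  (hg : ∀ x ∈ Icc (-s) s, g x = g' x) (hg0 : ∀ x < -s, g x = 0)

-- The right sides g and g' agree only on [-s,s]. Below -s the operator gives 0, so replacing f by
-- g' there makes it a solution with right side g' without changing the integrals. Every L²-solution
-- is thereby tied to the continuous one.
include hsT hg in
theorem sub_hankelOp_eq (hK0 : ∀ x ≤ 0, K x = 0) (hD : truncDet (truncKernel hc hT) T c s ≠ 0)
    {f : ℝ → ℂ} (hf : IsL2Solution K s c g f) {x : ℝ} (hx : x ≤ s) :
    g' x - c * hankelOp K s f x = hankelSol (truncKernel hc hT) T c s g' x := by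
  classical
  set h : ℝ → ℂ := fun y => if y ∈ Icc (-s) s then f y else g' y with hh
  have hfh : ∀ y ∈ Icc (-s) s, f y = h y := fun y hy => (if_pos hy).symm
  have hi : IntegrableOn h (Ioc (-T) s) := by
    have h1 : IntegrableOn f (Ioc (-T) s) :=
      ((hf.1.mono_measure (Measure.restrict_mono_set volume Ioc_subset_Iic_self)).integrable
        (by norm_num))
    have h2 : IntegrableOn g' (Ioc (-T) s) := integrable_bcf _ g'
    exact Integrable.piecewise (s := Icc (-s) s) measurableSet_Icc h1.integrableOn h2.integrableOn
  rw [hankel_integral_eq hc hT hK0 hsT.le hx hfh]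
  refine hankelSol_eq_of_ae hD hi ?_ x
  have hae := ae_restrict_of_ae_restrict_of_subset (Ioc_subset_Iic_self : Ioc (-T) s ⊆ Iic s) hf.2
  filter_upwards [hae, ae_restrict_mem measurableSet_Ioc] with y hy hyI
  rw [← hankel_integral_eq hc hT hK0 hsT.le hyI.2 hfh]
  rcases lt_or_ge y (-s) with h1 | h1
  · rw [hankelOp_eq_zero hK0 h1.le, mul_zero, add_zero, hh]
    exact if_neg fun h => by linarith [h.1]
  · rw [← hfh y ⟨h1, hyI.2⟩, hy, hg y ⟨h1, hyI.2⟩]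

theorem IsSolution.isL2Solution {f : ℝ → ℂ} (hf : IsSolution K s c g f) :
    IsL2Solution K s c g f :=
  ⟨hf.1, (ae_restrict_mem measurableSet_Iic).mono fun x hx => hf.2 x hx⟩

include hsT hg in
theorem IsSolution.eq_hankelSol (hK0 : ∀ x ≤ 0, K x = 0)
    (hD : truncDet (truncKernel hc hT) T c s ≠ 0)
    {f : ℝ → ℂ} (hf : IsSolution K s c g f) {x : ℝ} (hx : x ∈ Icc (-s) s) :
    f x = hankelSol (truncKernel hc hT) T c s g' x := by
  rw [← sub_hankelOp_eq hc hT hsT hg hK0 hD hf.isL2Solution hx.2, ← hg x hx, ← hf.2 x hx.2]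
  ring

include hs hg0 in
theorem IsSolution.eq_zero (hK0 : ∀ x ≤ 0, K x = 0)
    {f : ℝ → ℂ} (hf : IsSolution K s c g f) {x : ℝ} (hx : x < -s) : f x = 0 := by
  have := hf.2 x (by linarith)
  rwa [hankelOp_eq_zero hK0 hx.le, mul_zero, add_zero, hg0 x hx] at this

include hsT hg hg0 in
theorem uniquelySolvable_of_truncDet_ne_zero (hK0 : ∀ x ≤ 0, K x = 0)
    (hD : truncDet (truncKernel hc hT) T c s ≠ 0) : UniquelySolvable K s c g := by
  set S := hankelSol (truncKernel hc hT) T c s g' with hS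
  have hf : ∀ x ∈ Icc (-s) s, (Icc (-s) s).indicator S x = S x := fun x hx => indicator_of_mem hx _
  refine ⟨(Icc (-s) s).indicator S, ⟨?_, fun x hx => ?_⟩, fun h hh => ?_⟩
  · rw [memLp_indicator_iff_restrict measurableSet_Icc,
      Measure.restrict_restrict measurableSet_Icc,
      inter_eq_left.2 (Icc_subset_Iic_self : Icc (-s) s ⊆ Iic s)]
    exact MemLp.of_bound S.continuous.aestronglyMeasurable ‖S‖
      (Eventually.of_forall S.norm_coe_le_norm)
  · rcases lt_or_ge x (-s) with h1 | h1
    · rw [hankelOp_eq_zero hK0 h1.le, hg0 x h1, indicator_of_notMem fun h => by linarith [h.1]]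
      simp
    · rw [hankel_integral_eq hc hT hK0 hsT.le hx hf, hf x ⟨h1, hx⟩, hg x ⟨h1, hx⟩]
      exact hankelSol_spec_apply hD g' x
  · filter_upwards [hh.2, ae_restrict_mem measurableSet_Iic] with x hx hxs
    rcases lt_or_ge x (-s) with h1 | h1
    · rw [indicator_of_notMem fun h => by linarith [h.1]]
      rwa [hankelOp_eq_zero hK0 h1.le, mul_zero, add_zero, hg0 x h1] at hx
    · rw [hf x ⟨h1, hxs⟩, hS, ← sub_hankelOp_eq hc hT hsT hg hK0 hD hh hxs,
        ← hg x ⟨h1, hxs⟩, ← hx]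
      ring

end Truncation

theorem charIcc_eq_one {s x : ℝ} (hx : x ∈ Icc (-s) s) :
    charIcc s x = (1 : ℝ →ᵇ ℂ) x := by
  simp [charIcc, hx]

theorem charIcc_eq_zero {s x : ℝ} (hx : x < -s) : charIcc s x = 0 :=
  indicator_of_notMem (fun h => by linarith [h.1]) _

/-! ### All assertions for one sign of c. -/

/-- The assertions about the solutions `Φ` with right-hand side `1` for one value of `c`. -/
theorem hankel_solution_properties {K : ℝ → ℂ} (hc : Continuous K) (hK0 : ∀ x ≤ 0, K x = 0)
    {τ : ℝ} {c c' : ℂ} (hcc : c' = -c)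
    (hD : ∀ t, 0 ≤ t → t < τ → hankelDet K t c ≠ 0)
    (hD' : ∀ t, 0 ≤ t → t < τ → hankelDet K t c' ≠ 0) {Φ φ φ' : ℝ → ℝ → ℂ}
    (hΦ : ∀ t ∈ Ioo 0 τ, IsSolution K t c (charIcc t) (Φ t))
    (hφ : ∀ t ∈ Ioo 0 τ, IsSolution K t c (fun x => K (x + t)) (φ t))
    (hφ' : ∀ t ∈ Ioo 0 τ, IsSolution K t c' (fun x => K (x + t)) (φ' t))
    {t : ℝ} (ht : t ∈ Ioo 0 τ) :
    (ContinuousOn (Φ t) (Icc (-t) t) ∧ ∀ x < -t, Φ t x = 0) ∧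
    (Tendsto (Φ t) (𝓝[<] t) (𝓝 (Φ t t)) ∧ Φ t t ≠ 0) ∧
    (∀ x < t, x ≠ -t → HasDerivAt (fun s => Φ s x) (-(c * Φ t t) * φ t x) t ∧
      HasDerivAt (Φ t) (-(c * Φ t t) * φ' t x) x) ∧
    (∀ x : ℝ, x = t ∨ x = -t →
      HasDerivWithinAt (fun s => Φ s x) (-(c * Φ t t) * φ t x) (Ici t) t ∧
      HasDerivWithinAt (Φ t) (-(c * Φ t t) * φ' t x) (Icc (-t) t) x) ∧
    hankelDet K t c * Φ t t = hankelDet K t c' := by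
  -- T lies strictly beyond t, leaving room to vary t, and below τ, so the determinants do not
  -- vanish on [0,T).
  obtain ⟨T, htT, hTτ⟩ := exists_between ht.2
  have hT : 0 ≤ T := (ht.1.trans htT).le
  set k := truncKernel hc hT with hk
  have hku : UniformContinuous k := uniformContinuous_truncKernel hc hT
  have hk0 : ∀ x ≤ 0, k x = 0 := fun x hx => truncKernel_of_nonpos hc hT hK0 hx
  have hE : ∀ s ∈ Ico 0 T, truncDet k T c s ≠ 0 := fun s hs => by
    rw [← hankelDet_eq_truncDet hc hT hK0 c hs.2.le]
    exact hD s hs.1 (hs.2.trans hTτ)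
  have hE' : ∀ s ∈ Ico 0 T, truncDet k T (-c) s ≠ 0 := fun s hs => by
    rw [← hankelDet_eq_truncDet hc hT hK0 (-c) hs.2.le, ← hcc]
    exact hD' s hs.1 (hs.2.trans hTτ)
  have htI : t ∈ Ico 0 T := ⟨ht.1.le, htT⟩
  have hΦs : ∀ s ∈ Ioo 0 T, ∀ x ∈ Icc (-s) s, Φ s x = hankelSol k T c s 1 x := fun s hs x hx =>
    (hΦ s ⟨hs.1, hs.2.trans hTτ⟩).eq_hankelSol hc hT hs.2
      (fun x hx => charIcc_eq_one hx) hK0 (hE s (Ioo_subset_Ico_self hs)) hx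
  have hΦ0 : ∀ s ∈ Ioo 0 T, ∀ x < -s, Φ s x = 0 := fun s hs x hx =>
    (hΦ s ⟨hs.1, hs.2.trans hTτ⟩).eq_zero hs.1.le (fun x hx => charIcc_eq_zero hx) hK0 hx
  have hshift : ∀ x ∈ Icc (-t) t, K (x + t) = kernelShift k t x := fun x hx =>
    (truncKernel_eq hc hT hK0 (by linarith [hx.2])).symm
  have hshift0 : ∀ x < -t, K (x + t) = 0 := fun x hx => hK0 _ (by linarith)
  have htJ : t ∈ Ioo 0 T := ⟨ht.1, htT⟩
  have hφt : ∀ x ∈ Icc (-t) t, φ t x = hankelSol k T c t (kernelShift k t) x := fun x hx =>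
    (hφ t ht).eq_hankelSol hc hT htT hshift hK0 (hE t htI) hx
  have hφ0 : ∀ x < -t, φ t x = 0 := fun x hx => (hφ t ht).eq_zero ht.1.le hshift0 hK0 hx
  have hφt' : ∀ x ∈ Icc (-t) t, φ' t x = hankelSol k T (-c) t (kernelShift k t) x := fun x hx =>
    (hφ' t ht).eq_hankelSol hc hT htT hshift hK0 (by rw [hcc]; exact hE' t htI) hx |>.trans
      (by rw [hcc])
  have hφ0' : ∀ x < -t, φ' t x = 0 := fun x hx => (hφ' t ht).eq_zero ht.1.le hshift0 hK0 hx
  have htt : t ∈ Icc (-t) t := ⟨by linarith [ht.1], le_rfl⟩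
  have htn : -t ∈ Icc (-t) t := ⟨le_rfl, by linarith [ht.1]⟩
  have hcont : ContinuousOn (Φ t) (Icc (-t) t) :=
    (hankelSol k T c t 1).continuous.continuousOn.congr (hΦs t htJ)
  obtain ⟨hne, hone⟩ := hankelSol_one_eq hk0 hT ht.1.le htT.le (hE t htI) (hE' t htI)
  have hS : Ico 0 T ⊆ Ici (-T) := fun s hs => by
    have := hs.1; rw [mem_Ici]; linarith
  have hdt : ∀ x, HasDerivAt (fun s => hankelSol k T c s 1 x)
      (-(c * hankelSol k T c t 1 t) * hankelSol k T c t (kernelShift k t) x) t := fun x =>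
    (((BoundedContinuousFunction.evalCLM ℂ x : (ℝ →ᵇ ℂ) →L[ℂ] ℂ).restrictScalars
      ℝ).hasFDerivAt.comp_hasDerivWithinAt t
        (hasDerivWithinAt_hankelSol hku hS hE 1 htI)).hasDerivAt (Ico_mem_nhds ht.1 htT)
  set φs := hankelSol k T (-c) t (kernelShift k t)
  have hdx : ∀ x, HasDerivAt (fun x => hankelSol k T c t 1 t * (1 + c * ∫ y in x..t, φs y))
      (-(c * hankelSol k T c t 1 t) * φs x) x := fun x =>
    ((((intervalIntegral.integral_hasDerivAt_left (φs.continuous.intervalIntegrable _ _)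
      (φs.continuous.stronglyMeasurableAtFilter _ _) φs.continuous.continuousAt).const_mul
        c).const_add 1).const_mul _).congr_deriv (by ring)
  have hΦx : ∀ x ∈ Icc (-t) t, Φ t x =
      hankelSol k T c t 1 t * (1 + c * ∫ y in x..t, φs y) := fun x hx => by
    rw [hΦs t htJ x hx]
    exact hone x ⟨by linarith [hx.1], hx.2⟩
  refine ⟨⟨hcont, hΦ0 t htJ⟩, ⟨?_, ?_⟩, ?_, ?_, ?_⟩
  · refine (hcont t htt).mono_left (nhdsWithin_le_of_mem ?_)
    exact mem_of_superset (Ioo_mem_nhdsLT (by linarith [ht.1] : -t < t)) Ioo_subset_Icc_self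
  · rw [hΦs t htJ t htt]; exact hne
  · intro x hx hxt
    rcases lt_or_gt_of_ne hxt with h | h
    · rw [hφ0 x h, hφ0' x h, mul_zero]
      constructor
      · refine (hasDerivAt_const t (0 : ℂ)).congr_of_eventuallyEq ?_
        filter_upwards [Ioo_mem_nhds ht.1 htT, Iio_mem_nhds (by linarith : t < -x)] with s hs hs'
        exact hΦ0 s hs x (by linarith [mem_Iio.1 hs'])
      · refine (hasDerivAt_const x (0 : ℂ)).congr_of_eventuallyEq ?_
        filter_upwards [Iio_mem_nhds h] with y hy
        exact hΦ0 t htJ y hy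
    · have hxI : x ∈ Icc (-t) t := ⟨h.le, hx.le⟩
      rw [hφt x hxI, hφt' x hxI, hΦs t htJ t htt]
      constructor
      · refine (hdt x).congr_of_eventuallyEq ?_
        filter_upwards [Ioo_mem_nhds ht.1 htT, Ioi_mem_nhds hx,
          Ioi_mem_nhds (by linarith : -x < t)] with s hs hs' hs''
        exact hΦs s hs x ⟨by linarith [mem_Ioi.1 hs''], (mem_Ioi.1 hs').le⟩
      · refine (hdx x).congr_of_eventuallyEq ?_
        filter_upwards [Icc_mem_nhds h hx] with y hy using hΦx y hy
  · intro x hx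
    have hxI : x ∈ Icc (-t) t := by
      rcases hx with rfl | rfl
      · exact htt
      · exact htn
    rw [hφt x hxI, hφt' x hxI, hΦs t htJ t htt]
    constructor
    -- For s ≥ t the points x = ±t stay in [-s,s], where Φ is given by `hankelSol`; for s < t they
    -- leave it, so only the right derivative is available.
    · refine ((hdt x).hasDerivWithinAt).congr_of_eventuallyEq_of_mem ?_ self_mem_Ici
      filter_upwards [nhdsWithin_le_nhds (Ioo_mem_nhds ht.1 htT), self_mem_nhdsWithin] with s hs hs'
      rw [mem_Ici] at hs'
      exact hΦs s hs x ⟨by linarith [hxI.1], hxI.2.trans hs'⟩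
    · exact ((hdx x).hasDerivWithinAt).congr_of_mem hΦx hxI
  · rw [hankelDet_eq_truncDet hc hT hK0 c htT.le, hankelDet_eq_truncDet hc hT hK0 c' htT.le, hcc,
      hΦs t htJ t htt]
    exact truncDet_mul_hankelSol hku hk0 hE hE' htI

/-! ### Decay of Γ(w)/Γ(w+θ). -/

/-- Both ‖1 + θz‖ and ‖1 + z‖^θ are exp(θ Re z) up to a factor exp(O(‖z‖²)). It is used with z =
1/(w+j), for which the errors are summable over j. -/
theorem norm_one_add_mul_le {θ : ℝ} (hθ : 0 ≤ θ) {z : ℂ} (hz : 0 ≤ z.re) (hz' : ‖z‖ ≤ 4 / 3) :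
    ‖1 + θ * z‖ ≤ Real.exp ((θ ^ 2 / 2 + 5 * θ / 2) * ‖z‖ ^ 2) * ‖1 + z‖ ^ θ := by
  have hre := Complex.abs_re_le_norm z
  rw [abs_of_nonneg hz] at hre
  have hsq : ∀ a : ℝ, ‖1 + a * z‖ ^ 2 = 1 + (2 * a * z.re + a ^ 2 * ‖z‖ ^ 2) := by
    intro a
    rw [← Complex.normSq_eq_norm_sq, ← Complex.normSq_eq_norm_sq, Complex.normSq_apply,
      Complex.normSq_apply]
    simp
    ring
  have h1 : ‖1 + θ * z‖ ≤ Real.exp (θ * z.re + θ ^ 2 / 2 * ‖z‖ ^ 2) := by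
    refine (sq_le_sq₀ (norm_nonneg _) (Real.exp_pos _).le).1 ?_
    rw [hsq, ← Real.exp_nat_mul, add_comm]
    refine (Real.add_one_le_exp _).trans_eq ?_
    congr 1; push_cast; ring
  have h2 : Real.exp (z.re - 5 / 2 * ‖z‖ ^ 2) ≤ ‖1 + z‖ := by
    refine (sq_le_sq₀ (Real.exp_pos _).le (norm_nonneg _)).1 ?_
    have e := hsq 1
    simp only [Complex.ofReal_one, one_mul, mul_one, one_pow] at e
    set h := 2 * z.re + ‖z‖ ^ 2 with hh
    have hn := norm_nonneg z
    have h0 : 0 ≤ h := by positivity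
    -- Since ‖z‖ ≤ 4/3, this gives h²/2 ≤ (50/9)‖z‖², and 50/9 - 1 ≤ 5 = 2 · (5/2) accounts for the
    -- constant 5/2.
    have h3 : h ≤ 10 / 3 * ‖z‖ := by nlinarith
    have h4 : h - h ^ 2 / 2 ≤ Real.log (1 + h) := by
      refine le_trans ?_ (Real.le_log_one_add_of_nonneg h0)
      rw [le_div_iff₀ (by linarith)]
      nlinarith [pow_nonneg h0 3]
    rw [e, ← Real.exp_nat_mul, ← Real.le_log_iff_exp_le (by linarith)]
    refine le_trans ?_ h4
    push_cast
    nlinarith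
  have h3 : Real.exp (θ * (z.re - 5 / 2 * ‖z‖ ^ 2)) ≤ ‖1 + z‖ ^ θ := by
    rw [mul_comm, Real.exp_mul]
    gcongr
  calc _ ≤ _ := h1
    _ = Real.exp ((θ ^ 2 / 2 + 5 * θ / 2) * ‖z‖ ^ 2) *
        Real.exp (θ * (z.re - 5 / 2 * ‖z‖ ^ 2)) := by
      rw [← Real.exp_add]; congr 1; ring
    _ ≤ _ := by gcongr

/-- In Euler's limit formula the quotient is n^(-θ) ∏ (1 + θ/(w+j)). Each factor is compared with ‖1
+ 1/(w+j)‖^θ, whose product telescopes to (‖w+n+1‖/‖w‖)^θ. The accumulated error is bounded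
uniformly in w because ‖w+j‖ ≥ (3/4)(j+1). -/
theorem exists_norm_Gamma_div_le {θ : ℝ} (hθ : 0 < θ) :
    ∃ C : ℝ, 0 ≤ C ∧ ∀ w : ℂ, 3 / 4 ≤ w.re →
      ‖Complex.Gamma w / Complex.Gamma (w + θ)‖ ≤ C * ‖w‖ ^ (-θ) := by
  set D : ℝ := θ ^ 2 / 2 + 5 * θ / 2
  have hD : 0 ≤ D := by positivity
  have hsum : Summable fun j : ℕ => (16 / 9 : ℝ) * (1 / ((j + 1 : ℕ) : ℝ) ^ 2) :=
    ((summable_nat_add_iff 1).2 (Real.summable_one_div_nat_pow.2 one_lt_two)).mul_left _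
  set B : ℝ := ∑' j : ℕ, (16 / 9 : ℝ) * (1 / ((j + 1 : ℕ) : ℝ) ^ 2)
  refine ⟨Real.exp (D * B), (Real.exp_pos _).le, fun w hw => ?_⟩
  have hw0 : w ≠ 0 := fun h => by simp [h] at hw; linarith
  have hwn : 0 < ‖w‖ := norm_pos_iff.2 hw0
  have hne : ∀ j : ℕ, w + j ≠ 0 := fun j h => by
    have := congrArg Complex.re h
    simp at this
    have : (0 : ℝ) ≤ j := j.cast_nonneg
    linarith
  have hne' : ∀ j : ℕ, w + θ + j ≠ 0 := fun j h => by
    have := congrArg Complex.re h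
    simp at this
    have : (0 : ℝ) ≤ j := j.cast_nonneg
    linarith
  have hinv : ∀ j : ℕ, ‖1 / (w + j)‖ ≤ 4 / 3 * (1 / ((j + 1 : ℕ) : ℝ)) := by
    intro j
    have h1 : 3 / 4 * ((j + 1 : ℕ) : ℝ) ≤ ‖w + j‖ := by
      refine le_trans ?_ (Complex.re_le_norm _)
      simp
      have : (0 : ℝ) ≤ j := j.cast_nonneg
      linarith
    rw [norm_div, norm_one]
    calc 1 / ‖w + j‖ ≤ 1 / (3 / 4 * ((j + 1 : ℕ) : ℝ)) :=
          one_div_le_one_div_of_le (by positivity) h1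
      _ = _ := by field_simp
  have hterm : ∀ j : ℕ, ‖(w + θ + j) / (w + j)‖ ≤
      Real.exp (D * (16 / 9 * (1 / ((j + 1 : ℕ) : ℝ) ^ 2))) * ‖(w + (j + 1 : ℕ)) / (w + j)‖ ^ θ := by
    intro j
    have e1 : (w + θ + j) / (w + j) = 1 + θ * (1 / (w + j)) := by
      have := hne j; field_simp; ring
    have e2 : (w + (j + 1 : ℕ)) / (w + j) = 1 + 1 / (w + j) := by
      have := hne j; push_cast; field_simp; ring
    have hsq : ‖1 / (w + j)‖ ^ 2 ≤ 16 / 9 * (1 / ((j + 1 : ℕ) : ℝ) ^ 2) := by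
      calc _ ≤ (4 / 3 * (1 / ((j + 1 : ℕ) : ℝ))) ^ 2 := by gcongr; exact hinv j
        _ = _ := by rw [mul_pow]; field_simp; norm_num
    rw [e1, e2]
    refine (norm_one_add_mul_le hθ.le ?_ ?_).trans ?_
    · rw [one_div, Complex.inv_re]
      refine div_nonneg ?_ (Complex.normSq_nonneg _)
      simp
      have : (0 : ℝ) ≤ j := j.cast_nonneg
      linarith
    · refine (hinv j).trans ?_
      have : 1 / ((j + 1 : ℕ) : ℝ) ≤ 1 := by
        rw [div_le_one (by positivity)]; push_cast; linarith [(j.cast_nonneg : (0 : ℝ) ≤ j)]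
      linarith
    · gcongr
  have hprod : ∀ n : ℕ, ‖∏ j ∈ Finset.range n, (w + θ + j) / (w + j)‖ ≤
      Real.exp (D * B) * (‖w + n‖ / ‖w‖) ^ θ := by
    intro n
    rw [norm_prod]
    refine (Finset.prod_le_prod (fun _ _ => norm_nonneg _) fun j _ => hterm j).trans ?_
    rw [Finset.prod_mul_distrib, ← Real.exp_sum, Real.finsetProd_rpow _ _ fun _ _ => norm_nonneg _,
      ← Finset.mul_sum, ← norm_prod]
    have e : ∏ j ∈ Finset.range n, (w + (j + 1 : ℕ)) / (w + j) = (w + n) / w := by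
      have := Finset.prod_range_induction (fun j : ℕ => (w + (j + 1 : ℕ)) / (w + j))
        (fun n : ℕ => (w + n) / w) (by simp [hw0]) n (fun k _ => by
          have := hne k; field_simp)
      exact this
    rw [e, norm_div]
    gcongr
    exact hsum.sum_le_tsum _ fun _ _ => by positivity
  have hG : Tendsto (fun n => ‖Complex.GammaSeq w n / Complex.GammaSeq (w + θ) n‖) atTop
      (𝓝 ‖Complex.Gamma w / Complex.Gamma (w + θ)‖) := by
    refine ((Complex.GammaSeq_tendsto_Gamma w).div (Complex.GammaSeq_tendsto_Gamma (w + θ)) ?_).norm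
    exact Complex.Gamma_ne_zero_of_re_pos (by simp; linarith)
  have hlim : Tendsto (fun n : ℕ => Real.exp (D * B) * ((‖w + ((n + 1 : ℕ) : ℂ)‖ / n) / ‖w‖) ^ θ)
      atTop (𝓝 (Real.exp (D * B) * (1 / ‖w‖) ^ θ)) := by
    have h1 : Tendsto (fun n : ℕ => ‖w + ((n + 1 : ℕ) : ℂ)‖ / n) atTop (𝓝 1) := by
      have h2 : Tendsto (fun n : ℕ => (w + 1) * ((1 : ℝ) / (n : ℝ) : ℝ) + 1) atTop (𝓝 ((w + 1) * (0 : ℝ) + 1)) :=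
        ((Complex.continuous_ofReal.tendsto 0).comp tendsto_one_div_atTop_nhds_zero_nat
          |>.const_mul _).add_const _
      have h3 := h2.norm
      simp only [Complex.ofReal_zero, mul_zero, zero_add, norm_one] at h3
      refine h3.congr' ?_
      filter_upwards [eventually_gt_atTop 0] with n hn
      have hn' : (n : ℂ) ≠ 0 := by exact_mod_cast hn.ne'
      have e : ‖w + ((n + 1 : ℕ) : ℂ)‖ / n = ‖(w + ((n + 1 : ℕ) : ℂ)) / n‖ := by
        rw [norm_div, Complex.norm_natCast]
      rw [e]
      congr 1
      push_cast
      field_simp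
      ring
    exact ((h1.div_const _).rpow_const (Or.inr hθ.le)).const_mul _
  have e : Real.exp (D * B) * (1 / ‖w‖) ^ θ = Real.exp (D * B) * ‖w‖ ^ (-θ) := by
    rw [one_div, Real.inv_rpow hwn.le, Real.rpow_neg hwn.le]
  rw [← e]
  refine le_of_tendsto_of_tendsto hG hlim ?_
  filter_upwards [eventually_gt_atTop 0] with n hn
  have hn' : (n : ℂ) ≠ 0 := by exact_mod_cast hn.ne'
  have hnr : (0 : ℝ) < n := by exact_mod_cast hn
  have hf : (n.factorial : ℂ) ≠ 0 := by exact_mod_cast n.factorial_ne_zero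
  have hp1 : ∏ j ∈ Finset.range (n + 1), (w + j) ≠ 0 := Finset.prod_ne_zero_iff.2 fun j _ => hne j
  have hp2 : ∏ j ∈ Finset.range (n + 1), (w + θ + j) ≠ 0 :=
    Finset.prod_ne_zero_iff.2 fun j _ => hne' j
  have hnw : (n : ℂ) ^ w ≠ 0 := by simp [Complex.cpow_eq_zero_iff, hn']
  have hnθ : (n : ℂ) ^ (θ : ℂ) ≠ 0 := by simp [Complex.cpow_eq_zero_iff, hn']
  have e2 : Complex.GammaSeq w n / Complex.GammaSeq (w + θ) n =
      (∏ j ∈ Finset.range (n + 1), (w + θ + j) / (w + j)) / (n : ℂ) ^ (θ : ℂ) := by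
    rw [Complex.GammaSeq, Complex.GammaSeq, Complex.cpow_add _ _ hn', Finset.prod_div_distrib]
    field_simp
  rw [e2, norm_div, Complex.norm_natCast_cpow_of_pos hn, Complex.ofReal_re, div_le_iff₀ (by positivity)]
  refine (hprod (n + 1)).trans_eq ?_
  rw [mul_assoc, ← Real.mul_rpow (by positivity) hnr.le]
  congr 2
  field_simp

/-! ### Contour shift, bounds for ξ-quotients, and continuity of the kernel. -/

/-- A function which is holomorphic and `O(|a|^(-p))` with `p > 1` on the half-plane `Re a ≥ σ` has
vanishing integral over the line `Re a = σ`. -/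
theorem integral_verticalLine_eq_zero {f : ℂ → ℂ} {σ C p : ℝ} (hσ : 1 ≤ σ) (hp : 1 < p) (hC : 0 ≤ C)
    (hf : DifferentiableOn ℂ f {a | σ ≤ a.re}) (hb : ∀ a : ℂ, σ ≤ a.re → ‖f a‖ ≤ C * ‖a‖ ^ (-p)) :
    Integrable (fun y : ℝ => f (σ + y * Complex.I)) ∧ ∫ y : ℝ, f (σ + y * Complex.I) = 0 := by
  have hmem : ∀ y : ℝ, (σ + y * Complex.I : ℂ) ∈ {a : ℂ | σ ≤ a.re} := fun y => by simp
  have hcont : Continuous fun y : ℝ => f (σ + y * Complex.I) :=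
    hf.continuousOn.comp_continuous (by fun_prop) hmem
  have hint : Integrable (fun y : ℝ => f (σ + y * Complex.I)) := by
    have h1 : Integrable fun y : ℝ => (1 + ‖y‖) ^ (-p) :=
      integrable_one_add_norm (by simpa using hp)
    refine (h1.const_mul (C * 2 ^ p)).mono' hcont.aestronglyMeasurable
      (Eventually.of_forall fun y => ?_)
    refine (hb _ (hmem y)).trans ?_
    have h2 : (1 + ‖y‖) / 2 ≤ ‖(σ + y * Complex.I : ℂ)‖ := by
      have h3 := Complex.re_le_norm (σ + y * Complex.I)
      have h4 := Complex.abs_im_le_norm (σ + y * Complex.I)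
      simp at h3 h4
      rw [Real.norm_eq_abs]; linarith
    rw [mul_assoc]
    gcongr
    calc ‖(σ + y * Complex.I : ℂ)‖ ^ (-p) ≤ ((1 + ‖y‖) / 2) ^ (-p) :=
          Real.rpow_le_rpow_of_nonpos (by positivity) h2 (by linarith)
      _ = 2 ^ p * (1 + ‖y‖) ^ (-p) := by
          rw [Real.div_rpow (by positivity) (by norm_num), Real.rpow_neg (by norm_num : (0 : ℝ) ≤ 2)]
          field_simp
  refine ⟨hint, ?_⟩
  have hlim := intervalIntegral_tendsto_integral hint tendsto_neg_atTop_atBot tendsto_id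
  refine tendsto_nhds_unique hlim ?_
  have hbound : ∀ᶠ U : ℝ in atTop, ‖∫ y in (-U)..U, f (σ + y * Complex.I)‖ ≤
      4 * C * U ^ (-(p - 1)) := by
    filter_upwards [eventually_gt_atTop 0] with U hU
    -- On the other three sides of the rectangle [σ,σ+U] × [-U,U], of total length 4U, the function
    -- is at most C U^(-p); since p > 1 their contribution tends to 0.
    have hrect := Complex.integral_boundary_rect_eq_zero_of_differentiableOn f
      (⟨σ, -U⟩ : ℂ) (⟨σ + U, U⟩ : ℂ) (hf.mono fun a ha => by
        have := ha.1
        simp only [mem_preimage] at this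
        rw [uIcc_of_le (by linarith)] at this
        exact this.1)
    simp only [smul_eq_mul] at hrect
    have hUp : ∀ a : ℂ, σ ≤ a.re → U ≤ ‖a‖ → ‖f a‖ ≤ C * U ^ (-p) := fun a ha hUa =>
      (hb a ha).trans (mul_le_mul_of_nonneg_left
        (Real.rpow_le_rpow_of_nonpos hU hUa (by linarith)) hC)
    have hUU : U ^ (-p) * U = U ^ (-(p - 1)) := by
      rw [← Real.rpow_add_one hU.ne']; congr 1; ring
    have b1 : ‖∫ x : ℝ in σ..(σ + U), f (x + ((-U : ℝ) : ℂ) * Complex.I)‖ ≤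
        C * U ^ (-p) * |σ + U - σ| := by
      refine intervalIntegral.norm_integral_le_of_norm_le_const fun x hx => ?_
      rw [uIoc_of_le (by linarith)] at hx
      refine hUp _ (by simp; exact hx.1.le) ?_
      have := Complex.abs_im_le_norm (x + ((-U : ℝ) : ℂ) * Complex.I)
      simpa [abs_of_pos hU] using this
    have b2 : ‖∫ x : ℝ in σ..(σ + U), f (x + (U : ℂ) * Complex.I)‖ ≤
        C * U ^ (-p) * |σ + U - σ| := by
      refine intervalIntegral.norm_integral_le_of_norm_le_const fun x hx => ?_
      rw [uIoc_of_le (by linarith)] at hx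
      refine hUp _ (by simp; exact hx.1.le) ?_
      have := Complex.abs_im_le_norm (x + (U : ℂ) * Complex.I)
      simpa [abs_of_pos hU] using this
    have b3 : ‖∫ y : ℝ in (-U)..U, f (((σ + U : ℝ) : ℂ) + y * Complex.I)‖ ≤
        C * U ^ (-p) * |U - -U| := by
      refine intervalIntegral.norm_integral_le_of_norm_le_const fun y _ => ?_
      refine hUp _ (by simp; exact hU.le) ?_
      have := Complex.re_le_norm (((σ + U : ℝ) : ℂ) + y * Complex.I)
      simp at this ⊢
      linarith
    set I1 := ∫ x : ℝ in σ..(σ + U), f (x + ((-U : ℝ) : ℂ) * Complex.I)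
    set I2 := ∫ x : ℝ in σ..(σ + U), f (x + (U : ℂ) * Complex.I)
    set I3 := ∫ y : ℝ in (-U)..U, f (((σ + U : ℝ) : ℂ) + y * Complex.I)
    have e : Complex.I * ∫ y in (-U)..U, f (σ + y * Complex.I) = I1 - I2 + Complex.I * I3 := by
      linear_combination -hrect
    have e' : ‖∫ y in (-U)..U, f (σ + y * Complex.I)‖ = ‖I1 - I2 + Complex.I * I3‖ := by
      rw [← e, norm_mul, Complex.norm_I, one_mul]
    rw [e']
    have h5 : ‖I1 - I2 + Complex.I * I3‖ ≤ ‖I1‖ + ‖I2‖ + ‖I3‖ := by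
      refine (norm_add_le _ _).trans ?_
      rw [norm_mul, Complex.norm_I, one_mul]
      gcongr
      exact norm_sub_le _ _
    rw [add_sub_cancel_left, abs_of_pos hU] at b1 b2
    rw [show U - -U = 2 * U by ring, abs_of_pos (by linarith)] at b3
    rw [← hUU]
    linarith
  have h0 : Tendsto (fun U : ℝ => 4 * C * U ^ (-(p - 1))) atTop (𝓝 0) := by
    simpa using (tendsto_rpow_neg_atTop (by linarith : 0 < p - 1)).const_mul (4 * C)
  exact squeeze_zero_norm' hbound h0

/-- The constant is uniform over all coefficients bounded by 1, so it serves both ζ and 1/ζ, whose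
coefficients are the Möbius function. -/
theorem exists_norm_LSeries_le : ∃ Z : ℝ, ∀ f : ℕ → ℂ, (∀ n, ‖f n‖ ≤ 1) → ∀ s : ℂ,
    3 / 2 ≤ s.re → ‖LSeries f s‖ ≤ Z := by
  have hs : LSeriesSummable 1 ((3 / 2 : ℝ) : ℂ) := by
    rw [LSeriesSummable_one_iff, Complex.ofReal_re]; norm_num
  refine ⟨∑' n, ‖LSeries.term 1 ((3 / 2 : ℝ) : ℂ) n‖, fun f hf s h => ?_⟩
  refine tsum_of_norm_bounded hs.norm.hasSum fun n => ?_
  refine (LSeries.norm_term_le s (g := 1) (by simpa using hf n)).trans ?_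
  exact LSeries.norm_term_le_of_re_le_re 1 (by simpa using h) n

theorem exists_norm_riemannZeta_le : ∃ Z : ℝ, 0 ≤ Z ∧ ∀ s : ℂ, 3 / 2 ≤ s.re →
    ‖riemannZeta s‖ ≤ Z ∧ ‖(riemannZeta s)⁻¹‖ ≤ Z := by
  obtain ⟨Z, hZ⟩ := exists_norm_LSeries_le
  refine ⟨Z, (norm_nonneg _).trans (hZ 0 (by simp) 2 (by norm_num)), fun s hs => ?_⟩
  have h1 : 1 < s.re := by linarith
  constructor
  · rw [← LSeries_one_eq_riemannZeta h1]
    exact hZ 1 (by simp) s hs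
  · have h2 := LSeries_one_mul_Lseries_moebius h1
    rw [LSeries_one_eq_riemannZeta h1] at h2
    rw [inv_eq_of_mul_eq_one_right h2]
    refine hZ _ (fun n => ?_) s hs
    rw [Complex.norm_intCast]
    exact_mod_cast ArithmeticFunction.abs_moebius_le_one

theorem riemannXi_eq_of_one_lt_re {s : ℂ} (hs : 1 < s.re) :
    riemannXi s =
      1 / 2 * s * (s - 1) * (Real.pi : ℂ) ^ (-s / 2) * Complex.Gamma (s / 2) * riemannZeta s := by
  refine riemannXi_eq s (fun h => ?_) (fun h => ?_)
    (Complex.Gammaℝ_ne_zero_of_re_pos (by linarith))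
  · norm_num [h] at hs
  · norm_num [h] at hs

theorem riemannXi_ne_zero {s : ℂ} (hs : 1 < s.re) : riemannXi s ≠ 0 := by
  rw [riemannXi_eq_of_one_lt_re hs]
  have h0 : s ≠ 0 := fun h => by simp [h] at hs; linarith
  have h1 : s - 1 ≠ 0 := fun h => by
    rw [sub_eq_zero.1 h] at hs; simp at hs
  have h2 : (Real.pi : ℂ) ^ (-s / 2) ≠ 0 := by
    simp [Complex.cpow_eq_zero_iff, Real.pi_ne_zero]
  have h3 : Complex.Gamma (s / 2) ≠ 0 := Complex.Gamma_ne_zero_of_re_pos (by simp; linarith)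
  have h4 : riemannZeta s ≠ 0 := riemannZeta_ne_zero_of_one_le_re hs.le
  simp [h0, h1, h2, h3, h4]

theorem differentiable_riemannXi : Differentiable ℂ riemannXi := by
  have := differentiable_completedZeta₀
  unfold riemannXi
  fun_prop

/-- All the decay comes from the Γ-quotient with θ = ω. The polynomial quotients are at most 1 in
modulus, the power of π has constant modulus, and the ζ-quotient is bounded. -/
theorem exists_norm_riemannXi_div_le {ω : ℝ} (hω : 0 < ω) :
    ∃ C : ℝ, 0 ≤ C ∧ ∀ a : ℂ, 3 / 2 ≤ a.re →
      ‖riemannXi a / riemannXi (a + 2 * ω)‖ ≤ C * ‖a‖ ^ (-ω) := by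
  obtain ⟨C, hC, hΓ⟩ := exists_norm_Gamma_div_le hω
  obtain ⟨Z, hZ, hζ⟩ := exists_norm_riemannZeta_le
  refine ⟨Real.pi ^ ω * (C * 2 ^ ω) * (Z * Z), by positivity, fun a ha => ?_⟩
  set b : ℂ := a + 2 * ω with hb
  have hbre : b.re = a.re + 2 * ω := by simp [hb]
  have hb1 : 1 < b.re := by linarith
  have ha0 : a ≠ 0 := fun h => by simp [h] at ha; linarith
  have hb0 : b ≠ 0 := fun h => by rw [h] at hb1; simp at hb1; linarith
  have hb10 : b - 1 ≠ 0 := fun h => by rw [sub_eq_zero.1 h] at hb1; simp at hb1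
  have hpi : (Real.pi : ℂ) ≠ 0 := by exact_mod_cast Real.pi_ne_zero
  have hpb : (Real.pi : ℂ) ^ (-b / 2) ≠ 0 := by simp [Complex.cpow_eq_zero_iff, hpi]
  have hle : ∀ x y : ℂ, y ≠ 0 → 0 ≤ x.re → x.re ≤ y.re → x.im = y.im → ‖x / y‖ ≤ 1 := by
    intro x y hy h0 h1 h2
    rw [norm_div, div_le_one (norm_pos_iff.2 hy)]
    refine (sq_le_sq₀ (norm_nonneg _) (norm_nonneg _)).1 ?_
    rw [← Complex.normSq_eq_norm_sq, ← Complex.normSq_eq_norm_sq, Complex.normSq_apply,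
      Complex.normSq_apply, h2]
    nlinarith
  have f1 : ‖a / b‖ ≤ 1 := hle a b hb0 (by linarith) (by linarith) (by simp [hb])
  have f2 : ‖(a - 1) / (b - 1)‖ ≤ 1 :=
    hle _ _ hb10 (by simp; linarith) (by simp [hbre]; linarith) (by simp [hb])
  have f3 : ‖(Real.pi : ℂ) ^ (-a / 2) / (Real.pi : ℂ) ^ (-b / 2)‖ = Real.pi ^ ω := by
    rw [← Complex.cpow_sub _ _ hpi, Complex.norm_cpow_eq_rpow_re_of_pos Real.pi_pos]
    congr 1
    simp [hb]; ring
  have f4 : ‖Complex.Gamma (a / 2) / Complex.Gamma (b / 2)‖ ≤ C * 2 ^ ω * ‖a‖ ^ (-ω) := by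
    have h1 := hΓ (a / 2) (by simp; linarith)
    have e : b / 2 = a / 2 + ω := by rw [hb]; ring
    rw [e]
    refine h1.trans_eq ?_
    rw [norm_div, Real.div_rpow (norm_nonneg _) (norm_nonneg _), Complex.norm_ofNat,
      Real.rpow_neg (by norm_num : (0 : ℝ) ≤ 2)]
    field_simp
  have f5 : ‖riemannZeta a / riemannZeta b‖ ≤ Z * Z := by
    rw [div_eq_mul_inv, norm_mul]
    exact mul_le_mul (hζ a ha).1 (hζ b (by linarith)).2 (norm_nonneg _) hZ
  have e : riemannXi a / riemannXi b = (a / b) * ((a - 1) / (b - 1)) *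
      ((Real.pi : ℂ) ^ (-a / 2) / (Real.pi : ℂ) ^ (-b / 2)) *
      (Complex.Gamma (a / 2) / Complex.Gamma (b / 2)) * (riemannZeta a / riemannZeta b) := by
    rw [riemannXi_eq_of_one_lt_re (by linarith : 1 < a.re), riemannXi_eq_of_one_lt_re hb1]
    have h3 : Complex.Gamma (b / 2) ≠ 0 := Complex.Gamma_ne_zero_of_re_pos (by simp; linarith)
    have h4 : riemannZeta b ≠ 0 := riemannZeta_ne_zero_of_one_le_re hb1.le
    field_simp
  rw [e, norm_mul, norm_mul, norm_mul, norm_mul, f3]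
  calc _ ≤ 1 * 1 * Real.pi ^ ω * (C * 2 ^ ω * ‖a‖ ^ (-ω)) * (Z * Z) := by gcongr
    _ = _ := by ring

/-- On Im z = 1 + ω one has s - ω = 3/2 - iu, so this is the integral of a function of size
O(|a|^(-ων)) along Re a = 3/2. The condition ων > 1 gives both integrability and the vanishing of
the integral. -/
theorem xiQuotient_line {ω : ℝ} (hω : 0 < ω) {ν : ℕ} (hων : 1 < ω * ν) :
    Integrable (fun u : ℝ => xiQuotient ω ν (u + (1 + ω) * Complex.I)) ∧
      ∫ u : ℝ, xiQuotient ω ν (u + (1 + ω) * Complex.I) = 0 := by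
  obtain ⟨C, hC, hb⟩ := exists_norm_riemannXi_div_le hω
  set f : ℂ → ℂ := fun a => (riemannXi a / riemannXi (a + 2 * ω)) ^ ν
  have hf : DifferentiableOn ℂ f {a | (3 / 2 : ℝ) ≤ a.re} := by
    refine DifferentiableOn.pow (DifferentiableOn.div differentiable_riemannXi.differentiableOn
      (differentiable_riemannXi.comp (by fun_prop)).differentiableOn fun a ha => ?_) ν
    refine riemannXi_ne_zero ?_
    have : (3 / 2 : ℝ) ≤ a.re := ha
    simp; linarith
  have hbf : ∀ a : ℂ, (3 / 2 : ℝ) ≤ a.re → ‖f a‖ ≤ C ^ ν * ‖a‖ ^ (-(ω * ν)) := by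
    intro a ha
    rw [norm_pow]
    refine (pow_le_pow_left₀ (norm_nonneg _) (hb a ha) ν).trans_eq ?_
    rw [mul_pow, ← Real.rpow_mul_natCast (norm_nonneg _)]
    congr 2; ring
  obtain ⟨h1, h2⟩ := integral_verticalLine_eq_zero (by norm_num) hων (by positivity) hf hbf
  have e : (fun u : ℝ => xiQuotient ω ν (u + (1 + ω) * Complex.I)) =
      fun u : ℝ => f ((3 / 2 : ℝ) + (-u : ℝ) * Complex.I) := by
    ext u
    have e1 : (1 / 2 - Complex.I * (u + (1 + ω) * Complex.I) - ω : ℂ) =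
        (3 / 2 : ℝ) + (-u : ℝ) * Complex.I := by
      push_cast
      linear_combination (-(1 + (ω : ℂ))) * Complex.I_sq
    have e2 : (1 / 2 - Complex.I * (u + (1 + ω) * Complex.I) + ω : ℂ) =
        (3 / 2 : ℝ) + (-u : ℝ) * Complex.I + 2 * ω := by
      rw [← e1]; ring
    rw [xiQuotient, e1, e2]
  rw [e]
  exact ⟨h1.comp_neg, (integral_neg_eq_self
    (fun u : ℝ => f ((3 / 2 : ℝ) + u * Complex.I)) volume).trans h2⟩

/-- The inversion integral is continuous in x by dominated convergence, after its real exponential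
factor is taken out. It vanishes at x = 0, so it joins continuously with the value 0 prescribed for
x < 0. -/
theorem xiKernel_continuous_and_eq_zero {ω : ℝ} (hω : 0 < ω) {ν : ℕ} (hων : 1 < ω * ν) :
    Continuous (xiKernel ω ν) ∧ ∀ x ≤ 0, xiKernel ω ν x = 0 := by
  obtain ⟨hi, h0⟩ := xiQuotient_line hω hων
  set g : ℝ → ℂ := fun x => (1 / (2 * Real.pi : ℂ)) * ∫ u : ℝ,
    xiQuotient ω ν (u + (1 + ω) * Complex.I)
      * Complex.exp (-(Complex.I * (u + (1 + ω) * Complex.I) * x)) with hg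
  have hg0 : g 0 = 0 := by simp [hg, h0]
  have hgc : Continuous g := by
    have hexp : ∀ x u : ℝ, Complex.exp (-(Complex.I * (u + (1 + ω) * Complex.I) * x)) =
        Complex.exp ((1 + ω) * x) * Complex.exp (((-u * x : ℝ) : ℂ) * Complex.I) := by
      intro x u
      rw [← Complex.exp_add]
      congr 1
      push_cast
      linear_combination (-(1 + (ω : ℂ)) * x) * Complex.I_sq
    have e : g = fun x : ℝ => (1 / (2 * Real.pi : ℂ)) * (Complex.exp ((1 + ω) * x) *
        ∫ u : ℝ, xiQuotient ω ν (u + (1 + ω) * Complex.I) *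
          Complex.exp (((-u * x : ℝ) : ℂ) * Complex.I)) := by
      refine funext fun x => ?_
      simp only [hg, hexp]
      rw [← integral_const_mul (Complex.exp ((1 + ω) * x))]
      refine congrArg _ (integral_congr_ae (Eventually.of_forall fun u => ?_))
      simp only
      ring
    rw [e]
    refine continuous_const.mul ((by fun_prop : Continuous fun x : ℝ =>
      Complex.exp ((1 + ω) * x)).mul ?_)
    refine continuous_of_dominated
      (bound := fun u : ℝ => ‖xiQuotient ω ν (u + (1 + ω) * Complex.I)‖)
      (fun x => hi.aestronglyMeasurable.mul
        (by fun_prop : Continuous fun u : ℝ =>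
          Complex.exp (((-u * x : ℝ) : ℂ) * Complex.I)).aestronglyMeasurable)
      (fun x => Eventually.of_forall fun u => ?_) hi.norm
      (Eventually.of_forall fun u => by fun_prop)
    rw [norm_mul, Complex.norm_exp_ofReal_mul_I, mul_one]
  have hK : xiKernel ω ν = fun x => if 0 ≤ x then g x else 0 := by
    ext x
    rw [xiKernel]
    by_cases h : x < 0
    · rw [if_pos h, if_neg (not_le.2 h)]
    · rw [if_neg h, if_pos (not_lt.1 h)]
  constructor
  · rw [hK]
    exact Continuous.if_le hgc continuous_const continuous_const continuous_id
      fun x hx => by rw [← show (0 : ℝ) = x from hx]; exact hg0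
  · intro x hx
    rw [hK]
    simp only
    split_ifs with h
    · rw [le_antisymm hx h, hg0]
    · rfl

/-! ### The theorem, from the cases c = 1 and c = -1. -/

theorem theorem1 (ω : ℝ) (ν : ℕ) (hω : 0 < ω) (hν : 0 < ν) (hων : 1 < ω * ν)
    (τ : ℝ) (hτ : 0 < τ)
    (hdet : ∀ t : ℝ, 0 ≤ t → t < τ →
      hankelDet (xiKernel ω ν) t 1 ≠ 0 ∧ hankelDet (xiKernel ω ν) t (-1) ≠ 0) :
    -- unique solvability of the four integral equations
    (∀ t ∈ Ioo 0 τ,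
      UniquelySolvable (xiKernel ω ν) t 1 (charIcc t) ∧
      UniquelySolvable (xiKernel ω ν) t (-1) (charIcc t) ∧
      UniquelySolvable (xiKernel ω ν) t 1 (fun x => xiKernel ω ν (x + t)) ∧
      UniquelySolvable (xiKernel ω ν) t (-1) (fun x => xiKernel ω ν (x + t))) ∧
    -- properties of the solutions
    ∀ Φ Ψ φp φm : ℝ → ℝ → ℂ,
      (∀ t ∈ Ioo 0 τ, IsSolution (xiKernel ω ν) t 1 (charIcc t) (Φ t)) →
      (∀ t ∈ Ioo 0 τ, IsSolution (xiKernel ω ν) t (-1) (charIcc t) (Ψ t)) →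
      (∀ t ∈ Ioo 0 τ,
        IsSolution (xiKernel ω ν) t 1 (fun x => xiKernel ω ν (x + t)) (φp t)) →
      (∀ t ∈ Ioo 0 τ,
        IsSolution (xiKernel ω ν) t (-1) (fun x => xiKernel ω ν (x + t)) (φm t)) →
      ∀ t ∈ Ioo 0 τ,
        -- continuity in `x`
        (ContinuousOn (Φ t) (Icc (-t) t) ∧ ∀ x < -t, Φ t x = 0) ∧
        (ContinuousOn (Ψ t) (Icc (-t) t) ∧ ∀ x < -t, Ψ t x = 0) ∧
        -- the boundary values are the left limits, and do not vanish
        (Tendsto (Φ t) (𝓝[<] t) (𝓝 (Φ t t)) ∧ Φ t t ≠ 0) ∧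
        (Tendsto (Ψ t) (𝓝[<] t) (𝓝 (Ψ t t)) ∧ Ψ t t ≠ 0) ∧
        -- the derivative formulas, off the boundary points `x = t` and `x = -t`
        (∀ x < t, x ≠ -t →
          (DifferentiableAt ℝ (fun s => Φ s x) t ∧ DifferentiableAt ℝ (fun y => Φ t y) x ∧
            DifferentiableAt ℝ (fun s => Ψ s x) t ∧ DifferentiableAt ℝ (fun y => Ψ t y) x) ∧
          (φp t x = -(1 / Φ t t) * deriv (fun s => Φ s x) t ∧
            φp t x = (1 / Ψ t t) * deriv (fun y => Ψ t y) x) ∧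
          (φm t x = -(1 / Φ t t) * deriv (fun y => Φ t y) x ∧
            φm t x = (1 / Ψ t t) * deriv (fun s => Ψ s x) t)) ∧
        -- at the boundary points they hold with one-sided derivatives
        (∀ x : ℝ, x = t ∨ x = -t →
          HasDerivWithinAt (fun s => Φ s x) (-(Φ t t) * φp t x) (Ici t) t ∧
          HasDerivWithinAt (fun y => Ψ t y) (Ψ t t * φp t x) (Icc (-t) t) x ∧
          HasDerivWithinAt (fun y => Φ t y) (-(Φ t t) * φm t x) (Icc (-t) t) x ∧
          HasDerivWithinAt (fun s => Ψ s x) (Ψ t t * φm t x) (Ici t) t) ∧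
        -- the formula for `m`
        (mFun (xiKernel ω ν) t = 1 / Φ t t ∧ mFun (xiKernel ω ν) t = Ψ t t) := by
  obtain ⟨hKc, hK0⟩ := xiKernel_continuous_and_eq_zero hω hων
  set K := xiKernel ω ν
  have hDp : ∀ t, 0 ≤ t → t < τ → hankelDet K t 1 ≠ 0 := fun t h0 h1 => (hdet t h0 h1).1
  have hDm : ∀ t, 0 ≤ t → t < τ → hankelDet K t (-1) ≠ 0 := fun t h0 h1 => (hdet t h0 h1).2
  refine ⟨fun t ht => ?_, fun Φ Ψ φp φm hΦ hΨ hφp hφm t ht => ?_⟩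
  · obtain ⟨T, htT, hTτ⟩ := exists_between ht.2
    have hT : 0 ≤ T := (ht.1.trans htT).le
    have hE : ∀ c, hankelDet K t c ≠ 0 → truncDet (truncKernel hKc hT) T c t ≠ 0 := fun c h => by
      rwa [← hankelDet_eq_truncDet hKc hT hK0 c htT.le]
    have hone : ∀ c, hankelDet K t c ≠ 0 → UniquelySolvable K t c (charIcc t) := fun c h =>
      uniquelySolvable_of_truncDet_ne_zero hKc hT htT (fun x hx => charIcc_eq_one hx)
        (fun x hx => charIcc_eq_zero hx) hK0 (hE c h)
    have hshift : ∀ c, hankelDet K t c ≠ 0 → UniquelySolvable K t c (fun x => K (x + t)) :=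
      fun c h => uniquelySolvable_of_truncDet_ne_zero hKc hT htT
        (g' := kernelShift (truncKernel hKc hT) t)
        (fun x hx => (truncKernel_eq hKc hT hK0 (by linarith [hx.2])).symm)
        (fun x hx => hK0 _ (by linarith)) hK0 (hE c h)
    have h1 := hDp t ht.1.le ht.2
    have h2 := hDm t ht.1.le ht.2
    exact ⟨hone 1 h1, hone (-1) h2, hshift 1 h1, hshift (-1) h2⟩
  -- Φ is treated with c = 1 and Ψ with c = -1; in the second case φ⁺ and φ⁻ exchange roles.
  · obtain ⟨p1, ⟨p2, p3⟩, p4, p5, p6⟩ :=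
      hankel_solution_properties hKc hK0 (c' := -1) rfl hDp hDm hΦ hφp hφm ht
    obtain ⟨q1, ⟨q2, q3⟩, q4, q5, q6⟩ :=
      hankel_solution_properties hKc hK0 (c' := 1) (by norm_num) hDm hDp hΨ hφm hφp ht
    refine ⟨p1, q1, ⟨p2, p3⟩, ⟨q2, q3⟩, fun x hx hxt => ?_, fun x hx => ?_, ?_, ?_⟩
    · obtain ⟨a1, a2⟩ := p4 x hx hxt
      obtain ⟨b1, b2⟩ := q4 x hx hxt
      refine ⟨⟨a1.differentiableAt, a2.differentiableAt, b1.differentiableAt,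
        b2.differentiableAt⟩, ⟨?_, ?_⟩, ?_, ?_⟩
      · rw [a1.deriv]; field_simp
      · rw [b2.deriv]; field_simp
      · rw [a2.deriv]; field_simp
      · rw [b1.deriv]; field_simp
    · obtain ⟨a1, a2⟩ := p5 x hx
      obtain ⟨b1, b2⟩ := q5 x hx
      exact ⟨a1.congr_deriv (by ring), b2.congr_deriv (by ring), a2.congr_deriv (by ring),
        b1.congr_deriv (by ring)⟩
    · rw [mFun, div_eq_div_iff (hDm t ht.1.le ht.2) p3, p6, one_mul]
    · rw [mFun, div_eq_iff (hDm t ht.1.le ht.2), ← q6, mul_comm]
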